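/- Let $\mathbb K=\mathbb R$ or $\mathbb C$, $1\le p<\infty$, $N\ge 2$, and let $(e_j)_{j\ge1}$ be the canonical basis of $\ell^p(\mathbb N)$ over $\mathbb K$. For $s\in[N]=\{1,\dots,N\}$ let $w_s=(w_{s,n})_{n\ge1}$ be a bounded sequence in $\mathbb K$ and let $T_s=B_{w_s}$ be the unilateral weighted backward shift on $\ell^p(\mathbb N)$: $B_{w_s}e_1=0$ and $B_{w_s}e_n=w_{s,n}e_{n-1}$ for $n\ge2$. Put $W^s_{j,n}=\prod_{\nu=1}^n w_{s,j+\nu}$. Let $\mathcal A$ be either the family $\mathcal A_{uBd}$ of all sets $A\subset\mathbb N$ of positive upper Banach density $\limsup_{M\to\infty}\max_{k\ge1}\frac{\operatorname{card}(A\cap[k+1,k+M])}{M}$, or the family $\mathcal A_{ud}$ of all sets $A\subset\mathbb N$ of positive upper density $\limsup_{M\to\infty}\frac{\operatorname{card}(A\cap[1,M])}{M}$. The operators $T_1,\dots,T_N$ are called disjoint $\mathcal A$-hypercyclic (disjoint reiteratively hypercyclic for $\mathcal A_{uBd}$, disjoint upper frequently hypercyclic for $\mathcal A_{ud}$) if there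 is $x\in\ell^p(\mathbb N)$ such that $\{n:(T_1^nx,\dots,T_N^nx)\in U\}\in\mathcal A$ for every non-empty open set $U\subset\ell^p(\mathbb N)^N$. Theorem. $T_1,\dots,T_N$ are disjoint $\mathcal A$-hypercyclic if and only if the following two conditions hold: 1. for all $j\ge1$ and $s\in[N]$, $\sum_{n\ge1}\frac{1}{|W^s_{j,n}|^p}<\infty$ (with $1/0=\infty$, so that in particular no $W^s_{j,n}$ vanishes); 2. for every $l\ge1$, every family $(a_{s,j})_{s\in[N],\,1\le j\le l}$ of non-zero scalars in $\mathbb K$ and every $\varepsilon>0$, there is $A\in\mathcal A$ such that for all $s\ne t$ in $[N]$, all $n\in A$ and all $1\le j\le l$, $$\text{(a)}\quad \sum_{m\in A,\ m>n}\frac{|W^s_{j+m-n,n}|^p}{|W^t_{j,m}|^p}\le\varepsilon,\qquad\qquad \text{(b)}\quad \left|\frac{W^s_{j,n}}{W^t_{j,n}}-\frac{a_{s,j}}{a_{t,j}}\right|\le\varepsilon .$$ -/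

import Mathlib

open Filter Topology
open scoped ENNReal

namespace DisjointHypercyclic

noncomputable section

/-! ### Densities of sets of natural numbers -/

/-- The upper density `limsup_{N → ∞} card {n ≤ N : n ∈ A} / N`, with `n` ranging over the positive
integers. -/
def upperDensity (A : Set ℕ) : ℝ :=
  limsup (fun N : ℕ => ((A ∩ Set.Icc 1 N).ncard : ℝ) / N) atTop

/-- The upper Banach density `limsup_{N → ∞} max_{k ≥ 1} card (A ∩ [k + 1, k + N]) / N`.
The supremum is over a bounded set, with finitely many values for each `N`, so it is a maximum. -/
def upperBanachDensity (A : Set ℕ) : ℝ :=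
  limsup (fun N : ℕ =>
    ⨆ k : ℕ+, ((A ∩ Set.Icc ((k : ℕ) + 1) ((k : ℕ) + N)).ncard : ℝ) / N) atTop

/-- The family of sets of positive upper density. -/
def posUpperDensity : Set (Set ℕ) := {A | 0 < upperDensity A}

/-- The family of sets of positive upper Banach density. -/
def posUpperBanachDensity : Set (Set ℕ) := {A | 0 < upperBanachDensity A}

/-! ### Disjoint hypercyclicity along a family of sets of integers -/

section Dynamics

variable {𝕜 X : Type*} [NontriviallyNormedField 𝕜] [NormedAddCommGroup X] [NormedSpace 𝕜 X]

/-- `x` is an `𝒜`-hypercyclic vector for `T`: every non-empty open set `U` satisfies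
`{n : Tⁿ x ∈ U} ∈ 𝒜`. -/
def IsHypercyclicVector (𝒜 : Set (Set ℕ)) (T : X →L[𝕜] X) (x : X) : Prop :=
  ∀ U : Set X, IsOpen U → U.Nonempty → {n : ℕ | (T ^ n) x ∈ U} ∈ 𝒜

/-- `T 1, …, T N` are disjoint `𝒜`-hypercyclic: the direct sum operator on `X ^ N` has an
`𝒜`-hypercyclic vector on the diagonal. -/
def IsDisjointHypercyclic (𝒜 : Set (Set ℕ)) {N : ℕ} (T : Fin N → X →L[𝕜] X) : Prop :=
  ∃ x : X, IsHypercyclicVector 𝒜 (ContinuousLinearMap.piMap T) (fun _ : Fin N => x)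

end Dynamics

/-! ### Unilateral weighted backward shifts

The canonical basis of `ℓ^p` is indexed from `0` here: `e 0, e 1, e 2, …`. A weight sequence is
indexed in the same way, so that `B_w (e 0) = 0` and `B_w (e n) = w n • e (n - 1)` for `n ≥ 1`
(the entry `w 0` plays no role). -/

section Shift

variable {𝕜 : Type*} [RCLike 𝕜]

theorem norm_shift_le {w : ℕ → 𝕜} (hw : BddAbove (Set.range fun n => ‖w n‖)) (x : ℕ → 𝕜) (i : ℕ) :
    ‖w (i + 1) * x (i + 1)‖ ≤ (⨆ n, ‖w n‖) * ‖x (i + 1)‖ := by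
  rw [norm_mul]
  exact mul_le_mul_of_nonneg_right (le_ciSup hw (i + 1)) (norm_nonneg _)

theorem iSup_norm_nonneg (w : ℕ → 𝕜) : 0 ≤ ⨆ n, ‖w n‖ :=
  Real.iSup_nonneg fun _ => norm_nonneg _

theorem shift_sum_le {p : ℝ≥0∞} (hp : 0 < p.toReal) {w : ℕ → 𝕜}
    (hw : BddAbove (Set.range fun n => ‖w n‖)) (x : lp (fun _ : ℕ => 𝕜) p) (s : Finset ℕ) :
    ∑ i ∈ s, ‖w (i + 1) * x (i + 1)‖ ^ p.toReal ≤ ((⨆ n, ‖w n‖) * ‖x‖) ^ p.toReal := by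
  have h0 := iSup_norm_nonneg w
  calc ∑ i ∈ s, ‖w (i + 1) * x (i + 1)‖ ^ p.toReal
      ≤ ∑ i ∈ s, (⨆ n, ‖w n‖) ^ p.toReal * ‖x (i + 1)‖ ^ p.toReal := by
        refine Finset.sum_le_sum fun i _ => ?_
        rw [← Real.mul_rpow h0 (norm_nonneg _)]
        exact Real.rpow_le_rpow (norm_nonneg _) (norm_shift_le hw x i) hp.le
    _ = (⨆ n, ‖w n‖) ^ p.toReal * ∑ i ∈ s.map (addRightEmbedding 1), ‖x i‖ ^ p.toReal := by
        rw [Finset.sum_map, Finset.mul_sum]; rfl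
    _ ≤ (⨆ n, ‖w n‖) ^ p.toReal * ‖x‖ ^ p.toReal :=
        mul_le_mul_of_nonneg_left (lp.sum_rpow_le_norm_rpow hp x _) (Real.rpow_nonneg h0 _)
    _ = ((⨆ n, ‖w n‖) * ‖x‖) ^ p.toReal := (Real.mul_rpow h0 (lp.norm_nonneg' x)).symm

theorem memℓp_shift {p : ℝ≥0∞} [hp : Fact (1 ≤ p)] {w : ℕ → 𝕜}
    (hw : BddAbove (Set.range fun n => ‖w n‖)) (x : lp (fun _ : ℕ => 𝕜) p) :
    Memℓp (fun i : ℕ => w (i + 1) * x (i + 1)) p := by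
  have hp0 : p ≠ 0 := (zero_lt_one.trans_le hp.out).ne'
  rcases eq_or_ne p ∞ with rfl | hpt
  · refine memℓp_infty ⟨(⨆ n, ‖w n‖) * ‖x‖, ?_⟩
    rintro _ ⟨i, rfl⟩
    exact (norm_shift_le hw x i).trans
      (mul_le_mul_of_nonneg_left (lp.norm_apply_le_norm hp0 x _) (iSup_norm_nonneg w))
  · exact memℓp_gen' (shift_sum_le (ENNReal.toReal_pos hp0 hpt) hw x)

/-- The unilateral weighted backward shift `B_w` on `ℓ^p` with bounded weight sequence `w`:
`(B_w x) i = w (i + 1) * x (i + 1)`. -/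
def weightedShift (p : ℝ≥0∞) [hp : Fact (1 ≤ p)] (w : ℕ → 𝕜)
    (hw : BddAbove (Set.range fun n => ‖w n‖)) :
    lp (fun _ : ℕ => 𝕜) p →L[𝕜] lp (fun _ : ℕ => 𝕜) p :=
  LinearMap.mkContinuous
    { toFun := fun x => ⟨fun i => w (i + 1) * x (i + 1), memℓp_shift hw x⟩
      map_add' := fun x y => by
        ext i
        exact mul_add _ _ _
      map_smul' := fun c x => by
        ext i
        exact mul_left_comm _ _ _ }
    (⨆ n, ‖w n‖) fun x => by
      have hp0 : p ≠ 0 := (zero_lt_one.trans_le hp.out).ne'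
      have h0 := mul_nonneg (iSup_norm_nonneg w) (norm_nonneg x)
      rcases eq_or_ne p ∞ with rfl | hpt
      · exact lp.norm_le_of_forall_le h0 fun i => (norm_shift_le hw x i).trans
          (mul_le_mul_of_nonneg_left (lp.norm_apply_le_norm hp0 x _) (iSup_norm_nonneg w))
      · exact lp.norm_le_of_forall_sum_le (ENNReal.toReal_pos hp0 hpt) h0
          (shift_sum_le (ENNReal.toReal_pos hp0 hpt) hw x)

theorem weightedShift_apply (p : ℝ≥0∞) [Fact (1 ≤ p)] (w : ℕ → 𝕜)
    (hw : BddAbove (Set.range fun n => ‖w n‖)) (x : lp (fun _ : ℕ => 𝕜) p) (i : ℕ) :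
    weightedShift p w hw x i = w (i + 1) * x (i + 1) := rfl

/-- The weight products `W_{j, n} = ∏_{ν = 1}^{n} w_{j + ν}`, so that
`B_w ^ n (e (j + n)) = W_{j, n} • e j`. -/
def weightProd (w : ℕ → 𝕜) (j n : ℕ) : 𝕜 := ∏ ν ∈ Finset.Icc 1 n, w (j + ν)

end Shift

end

end DisjointHypercyclic

/-! Both families have one description: `A` belongs to the family iff, for some `δ > 0`, arbitrarily
long windows starting in a fixed set `K` contain a proportion above `δ` of `A` (`K = {0}` for upper
density, all `k ≥ 1` for upper Banach density). The argument then runs for an arbitrary `K`.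

Necessity rests on the coordinates of `T_s ^ n x`, which are `W^s_{i,n} x_{i+n}`. If `n` and `n + k`
are both times at which the orbit of `x` is near `e 0`, then `W_{0,n+k} = W_{0,k} W_{k,n}` bounds `1
/ |W_{0,k}|` by twice the `k`-th coordinate of `T ^ n x - e 0`. So `1 / |W_{0,k}|^p` is summable,
uniformly in `n`, over the differences `k` of the return set. `tsum_lt_top_of_tsum_differences_le`
passes to all `k`: the differences that occur often form a syndetic set, double counting bounds the
sum over them, and bounded weights fill the gaps. Condition 2 is read off from visits near vectors
with coordinates `a_{s,j}`: (a) from the coordinates beyond the target's support, (b) from the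
quotient of the coordinates at `j`.

Sufficiency needs one reference shift `t` only. The vector `∑_j ∑_{n ∈ B} (a_{t,j} / W^t_{j,n})
e_{j+n}` is sent by `T_s ^ n`, `n ∈ B`, close to `∑_j a_{s,j} e_j`: terms with `m < n` are killed by
separation of `B`, the term `m = n` is right by (b), those with `m > n` are small by (a). Truncating
`B` makes the vector small, so it can be added to any finitely supported one
(`exists_dense_visits`); the density obtained depends on the target only, and Baire's theorem
concludes. -/

namespace DisjointHypercyclic

/-! ### Families of sets with dense windows -/

/-- There are arbitrarily long windows `[k + 1, k + M]` with `k ∈ K` in which `A` has more than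
`δ * M` elements. -/
def HasDenseWindows (K : Set ℕ) (δ : ℝ) (A : Set ℕ) : Prop :=
  ∀ m : ℕ, ∃ M ≥ m, ∃ k ∈ K, δ * M < ((A ∩ Set.Icc (k + 1) (k + M)).ncard : ℝ)

theorem finite_inter_Icc (A : Set ℕ) (a b : ℕ) : (A ∩ Set.Icc a b).Finite :=
  (Set.finite_Icc a b).subset Set.inter_subset_right

theorem ncard_inter_window_le (A : Set ℕ) (k M : ℕ) :
    (A ∩ Set.Icc (k + 1) (k + M)).ncard ≤ M := by
  refine (Set.ncard_le_ncard Set.inter_subset_right (Set.finite_Icc _ _)).trans ?_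
  rw [← Finset.coe_Icc, Set.ncard_coe_finset, Nat.card_Icc]
  omega

theorem window_density_le_one (A : Set ℕ) (k M : ℕ) :
    ((A ∩ Set.Icc (k + 1) (k + M)).ncard : ℝ) / M ≤ 1 :=
  div_le_one_of_le₀ (by exact_mod_cast ncard_inter_window_le A k M) M.cast_nonneg

/-- Covers both densities at once: `hf` and `hf'` say that `f M` is the supremum of the proportions
over windows starting in `K`, and a strict lower bound on a supremum is already attained by one
window. -/
theorem exists_window_iff {K : Set ℕ} (hK : K.Nonempty) {A : Set ℕ} {f : ℕ → ℝ}
    (hf1 : ∀ M, f M ≤ 1)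
    (hf : ∀ M, ∀ k ∈ K, ((A ∩ Set.Icc (k + 1) (k + M)).ncard : ℝ) / M ≤ f M)
    (hf' : ∀ M c, c < f M → ∃ k ∈ K, c < ((A ∩ Set.Icc (k + 1) (k + M)).ncard : ℝ) / M) :
    0 < limsup f atTop ↔ ∃ δ > 0, HasDenseWindows K δ A := by
  obtain ⟨k₀, hk₀⟩ := hK
  have hf0 : ∀ M, 0 ≤ f M := fun M => le_trans (by positivity) (hf M k₀ hk₀)
  have hbdd : IsBoundedUnder (· ≤ ·) atTop f := isBoundedUnder_of ⟨1, hf1⟩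
  have hcob : IsCoboundedUnder (· ≤ ·) atTop f :=
    (isBoundedUnder_of ⟨0, hf0⟩ : IsBoundedUnder (· ≥ ·) atTop f).isCoboundedUnder_le
  constructor
  · intro h
    obtain ⟨δ, hδ, hδ'⟩ := exists_between h
    refine ⟨δ, hδ, fun m => ?_⟩
    obtain ⟨M, hM, hlt⟩ := (frequently_atTop.1 (frequently_lt_of_lt_limsup hcob hδ')) (m + 1)
    obtain ⟨k, hk, hlt⟩ := hf' M δ hlt
    refine ⟨M, by omega, k, hk, ?_⟩
    rwa [lt_div_iff₀ (by exact_mod_cast (by omega : 0 < M))] at hlt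
  · rintro ⟨δ, hδ, h⟩
    refine hδ.trans_le (le_limsup_of_frequently_le (frequently_atTop.2 fun m => ?_) hbdd)
    obtain ⟨M, hM, k, hk, hlt⟩ := h (m + 1)
    refine ⟨M, by omega, le_trans ?_ (hf M k hk)⟩
    rw [le_div_iff₀ (by exact_mod_cast (by omega : 0 < M))]
    exact hlt.le

theorem mem_posUpperDensity_iff {A : Set ℕ} :
    A ∈ posUpperDensity ↔ ∃ δ > 0, HasDenseWindows {0} δ A := by
  refine exists_window_iff (Set.singleton_nonempty 0) (fun M => ?_) ?_ ?_
  · simpa using window_density_le_one A 0 M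
  · rintro M k rfl
    simp
  · intro M c h
    exact ⟨0, rfl, by simpa using h⟩

theorem mem_posUpperBanachDensity_iff {A : Set ℕ} :
    A ∈ posUpperBanachDensity ↔ ∃ δ > 0, HasDenseWindows {k | 1 ≤ k} δ A := by
  refine exists_window_iff ⟨1, le_rfl⟩ (fun M => ?_) ?_ ?_
  · exact ciSup_le fun k => window_density_le_one A k M
  · intro M k hk
    exact le_ciSup (f := fun k : ℕ+ =>
      ((A ∩ Set.Icc ((k : ℕ) + 1) ((k : ℕ) + M)).ncard : ℝ) / M)
      ⟨1, by rintro _ ⟨k, rfl⟩; exact window_density_le_one A k M⟩ ⟨k, hk⟩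
  · intro M c h
    obtain ⟨k, hk⟩ := exists_lt_of_lt_ciSup h
    exact ⟨k, k.2, hk⟩

theorem exists_windows_of_family {𝒜 : Set (Set ℕ)}
    (h𝒜 : 𝒜 = posUpperBanachDensity ∨ 𝒜 = posUpperDensity) :
    ∃ K : Set ℕ, ∀ A, A ∈ 𝒜 ↔ ∃ δ > 0, HasDenseWindows K δ A := by
  rcases h𝒜 with rfl | rfl
  · exact ⟨_, fun A => mem_posUpperBanachDensity_iff⟩
  · exact ⟨_, fun A => mem_posUpperDensity_iff⟩

namespace HasDenseWindows

variable {K : Set ℕ} {δ : ℝ} {A : Set ℕ}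

theorem mono {B : Set ℕ} (h : HasDenseWindows K δ A) (hAB : A ⊆ B) : HasDenseWindows K δ B := by
  intro m
  obtain ⟨M, hM, k, hk, hlt⟩ := h m
  refine ⟨M, hM, k, hk, hlt.trans_le ?_⟩
  exact_mod_cast Set.ncard_le_ncard (Set.inter_subset_inter_left _ hAB) (finite_inter_Icc B _ _)

theorem inter_Ici (h : HasDenseWindows K δ A) (hδ : 0 < δ) (n₀ : ℕ) :
    HasDenseWindows K (δ / 2) (A ∩ Set.Ici n₀) := by
  intro m
  -- In windows longer than this, the at most `n₀` discarded elements are fewer than `δ * M / 2`.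
  obtain ⟨m', hm'⟩ := exists_nat_gt (2 * n₀ / δ)
  obtain ⟨M, hM, k, hk, hlt⟩ := h (max m m')
  refine ⟨M, (le_max_left _ _).trans hM, k, hk, ?_⟩
  have hsub : A ∩ Set.Icc (k + 1) (k + M) ⊆
      (A ∩ Set.Ici n₀ ∩ Set.Icc (k + 1) (k + M)) ∪ (Finset.range n₀ : Set ℕ) := by
    rintro n ⟨hn, hn'⟩
    by_cases h : n₀ ≤ n
    · exact Or.inl ⟨⟨hn, h⟩, hn'⟩
    · exact Or.inr (by simpa using h)
  have hcard : (A ∩ Set.Icc (k + 1) (k + M)).ncard ≤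
      (A ∩ Set.Ici n₀ ∩ Set.Icc (k + 1) (k + M)).ncard + n₀ := by
    refine (Set.ncard_le_ncard hsub
      ((finite_inter_Icc _ _ _).union (Finset.finite_toSet _))).trans ?_
    refine (Set.ncard_union_le _ _).trans ?_
    rw [Set.ncard_coe_finset, Finset.card_range]
  have hcard' : ((A ∩ Set.Icc (k + 1) (k + M)).ncard : ℝ) ≤
      (A ∩ Set.Ici n₀ ∩ Set.Icc (k + 1) (k + M)).ncard + n₀ := by exact_mod_cast hcard
  have hM' : (m' : ℝ) ≤ M := by exact_mod_cast (le_max_right _ _).trans hM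
  have : 2 * n₀ < δ * M := by
    rw [div_lt_iff₀ hδ] at hm'
    nlinarith
  linarith

/-- A residue class modulo `L` inherits dense windows. -/
theorem exists_residue (h : HasDenseWindows K δ A) {L : ℕ} (hL : 0 < L) :
    ∃ r, HasDenseWindows K (δ / L) (A ∩ {n | n % L = r}) := by
  by_contra! hcon
  simp only [HasDenseWindows, not_forall, not_exists, not_and, not_lt] at hcon
  choose m hm using hcon
  obtain ⟨M, hM, k, hk, hlt⟩ := h ((Finset.range L).sup m)
  have hsub : A ∩ Set.Icc (k + 1) (k + M) ⊆
      ⋃ r ∈ Finset.range L, (A ∩ {n | n % L = r} ∩ Set.Icc (k + 1) (k + M)) := by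
    rintro n ⟨hn, hn'⟩
    simp only [Set.mem_iUnion, Finset.mem_range]
    exact ⟨n % L, Nat.mod_lt _ hL, ⟨hn, rfl⟩, hn'⟩
  have hcard : ((A ∩ Set.Icc (k + 1) (k + M)).ncard : ℝ) ≤
      ∑ r ∈ Finset.range L, ((A ∩ {n | n % L = r} ∩ Set.Icc (k + 1) (k + M)).ncard : ℝ) := by
    exact_mod_cast (Set.ncard_le_ncard hsub
      ((Finset.range L).finite_toSet.biUnion fun _ _ => finite_inter_Icc _ _ _)).trans
      (Finset.set_ncard_biUnion_le _ _)
  have hle := Finset.sum_le_card_nsmul (Finset.range L)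
    (fun r => ((A ∩ {n | n % L = r} ∩ Set.Icc (k + 1) (k + M)).ncard : ℝ)) (δ / L * M)
    fun r hr => hm r M ((Finset.le_sup hr).trans hM) k hk
  have hL' : (L : ℝ) ≠ 0 := by exact_mod_cast hL.ne'
  rw [Finset.card_range, nsmul_eq_mul] at hle
  have : (L : ℝ) * (δ / L * M) = δ * M := by field_simp
  linarith

end HasDenseWindows

/-! ### Differences of sets with dense windows -/

/-- A Bonferroni bound: a set joined to a union of `r` others loses at most `r * c` to overlaps, and
these losses add up to at most `F.card ^ 2 * c`. -/
theorem card_biUnion_lower_bound {ι α : Type*} [DecidableEq α] [DecidableEq ι] {X : ι → Finset α}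
    {b c : ℝ} (hc : 0 ≤ c) (F : Finset ι) (hb : ∀ i ∈ F, b ≤ (X i).card)
    (hinter : ∀ i ∈ F, ∀ j ∈ F, i ≠ j → ((X i ∩ X j).card : ℝ) ≤ c) :
    F.card * b - F.card ^ 2 * c ≤ ((F.biUnion X).card : ℝ) := by
  induction F using Finset.induction_on with
  | empty => simp
  | insert i F hi ih =>
    have ih' := ih (fun j hj => hb j (Finset.mem_insert_of_mem hj)) fun j hj k hk =>
      hinter j (Finset.mem_insert_of_mem hj) k (Finset.mem_insert_of_mem hk)
    have h1 : ((X i ∩ F.biUnion X).card : ℝ) ≤ F.card * c := by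
      rw [Finset.inter_biUnion]
      calc ((F.biUnion fun j => X i ∩ X j).card : ℝ) ≤ ∑ j ∈ F, ((X i ∩ X j).card : ℝ) := by
            exact_mod_cast Finset.card_biUnion_le
        _ ≤ F.card • c := Finset.sum_le_card_nsmul _ _ _ fun j hj =>
            hinter i (Finset.mem_insert_self _ _) j (Finset.mem_insert_of_mem hj)
              (by rintro rfl; exact hi hj)
        _ = F.card * c := nsmul_eq_mul _ _
    have h2 : ((X i ∪ F.biUnion X).card : ℝ) + (X i ∩ F.biUnion X).card =
        (X i).card + (F.biUnion X).card := by
      exact_mod_cast Finset.card_union_add_card_inter _ _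
    have h3 := hb i (Finset.mem_insert_self _ _)
    rw [Finset.biUnion_insert, Finset.card_insert_of_notMem hi]
    push_cast
    nlinarith [mul_nonneg (Nat.cast_nonneg (α := ℝ) F.card) hc]

/-- If finite sets `B i` fill a proportion `δ` of windows whose lengths tend to infinity along an
ultrafilter, then the differences that occur with proportion at least `η` along the ultrafilter are
met by every set of more than `q` integers. -/
theorem exists_difference_of_card {U : Ultrafilter ℕ} {B : ℕ → Finset ℕ} {M k : ℕ → ℕ} {δ : ℝ}
    (hM : Tendsto M U atTop) (hB : ∀ i, B i ⊆ Finset.Icc (k i + 1) (k i + M i))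
    (hδ : ∀ i, δ * M i < (B i).card) {q : ℕ} (hq : 4 ≤ q * δ) (hq0 : 0 < q) {F : Finset ℕ}
    (hF : F.card = q) :
    ∃ a ∈ F, ∃ b ∈ F, a < b ∧
      ∀ᶠ i in (U : Filter ℕ),
        1 / (q : ℝ) ^ 2 * M i ≤ ((B i).filter fun n => n + (b - a) ∈ B i).card := by
  by_contra! hcon
  -- Along an ultrafilter, not holding eventually means failing eventually; so a single index `i`
  -- defeats all the finitely many pairs.
  have hev : ∀ᶠ i in (U : Filter ℕ), ∀ a ∈ F, ∀ b ∈ F, a < b →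
      (((B i).filter fun n => n + (b - a) ∈ B i).card : ℝ) < 1 / (q : ℝ) ^ 2 * M i := by
    rw [Filter.eventually_all_finset]
    intro a ha
    rw [Filter.eventually_all_finset]
    intro b hb
    by_cases hab : a < b
    · filter_upwards [hcon a ha b hb hab] with i hi _ using hi
    · exact Filter.Eventually.of_forall fun i h => absurd h hab
  obtain ⟨i, hi, hMi⟩ := (hev.and (hM.eventually_ge_atTop (F.sup id + 1))).exists
  set c : ℝ := 1 / (q : ℝ) ^ 2 * M i with hc
  -- The `q` translates `B i + a` have more than `δ * M i` elements each and overlap pairwise in at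
  -- most `M i / q ^ 2`, so their union has at least `(q * δ - 1) * M i ≥ 3 * M i` elements; yet it
  -- lies in an interval of length `2 * M i`.
  set X : ℕ → Finset ℕ := fun a => (B i).image (· + a) with hX
  have hXcard : ∀ a, (X a).card = (B i).card := fun a =>
    Finset.card_image_of_injective _ (add_left_injective a)
  have hlt : ∀ a ∈ F, ∀ b ∈ F, a < b → ((X a ∩ X b).card : ℝ) ≤ c := by
    intro a ha b hb hab
    refine le_trans ?_ (hi a ha b hb hab).le
    have hsub : X a ∩ X b ⊆ ((B i).filter fun n => n + (b - a) ∈ B i).image (· + b) := by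
      intro x hx
      simp only [hX, Finset.mem_inter, Finset.mem_image, Finset.mem_filter] at hx ⊢
      obtain ⟨⟨n, hn, rfl⟩, m, hm, hmn⟩ := hx
      exact ⟨m, ⟨hm, by rwa [show m + (b - a) = n by omega]⟩, hmn⟩
    exact_mod_cast (Finset.card_le_card hsub).trans Finset.card_image_le
  have hlow := card_biUnion_lower_bound (X := X) (b := δ * M i) (c := c) (by positivity) F
    (fun a _ => by rw [hXcard]; exact (hδ i).le) (by
      intro a ha b hb hab
      rcases lt_or_gt_of_ne hab with h | h
      · exact hlt a ha b hb h
      · rw [Finset.inter_comm]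
        exact hlt b hb a ha h)
  have hup : ((F.biUnion X).card : ℝ) ≤ 2 * M i := by
    have hsub : F.biUnion X ⊆ Finset.Ico (k i + 1) (k i + 1 + 2 * M i) := by
      intro x hx
      simp only [hX, Finset.mem_biUnion, Finset.mem_image] at hx
      obtain ⟨a, ha, n, hn, rfl⟩ := hx
      have h1 := Finset.mem_Icc.1 (hB i hn)
      have h2 : a ≤ F.sup id := Finset.le_sup (f := id) ha
      rw [Finset.mem_Ico]
      omega
    have := Finset.card_le_card hsub
    rw [Nat.card_Ico] at this
    exact_mod_cast this.trans (by omega)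
  have hMpos : (1 : ℝ) ≤ M i := by exact_mod_cast (by omega : 1 ≤ M i)
  have hq' : (q : ℝ) ≠ 0 := by exact_mod_cast hq0.ne'
  have hc2 : (F.card : ℝ) ^ 2 * c = M i := by
    rw [hF, hc]
    field_simp
  rw [hc2, hF] at hlow
  nlinarith

/-- Take a largest `F` without differences in `S`. A new point `x` beyond `F` must create such a
difference `x - a` with `a ∈ F`, and for `x = k + max F + 1` it lies within `max F + 1` of `k`. -/
theorem exists_syndetic {S : Set ℕ} {q : ℕ}
    (h : ∀ F : Finset ℕ, F.card = q → ∃ a ∈ F, ∃ b ∈ F, a < b ∧ b - a ∈ S) :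
    ∃ G : ℕ, ∀ k, ∃ g ≤ G, k + g ∈ S := by
  classical
  have hbound : ∀ F : Finset ℕ, (∀ a ∈ F, ∀ b ∈ F, a < b → b - a ∉ S) → F.card ≤ q := by
    intro F hF
    by_contra! hlt
    obtain ⟨F', hF', hcard⟩ := Finset.exists_subset_card_eq hlt.le
    obtain ⟨a, ha, b, hb, hab, hS⟩ := h F' hcard
    exact hF a (hF' ha) b (hF' hb) hab hS
  obtain ⟨c, ⟨F, hF, rfl⟩, hmax⟩ : ∃ c,
      (∃ F : Finset ℕ, (∀ a ∈ F, ∀ b ∈ F, a < b → b - a ∉ S) ∧ F.card = c) ∧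
      ∀ F : Finset ℕ, (∀ a ∈ F, ∀ b ∈ F, a < b → b - a ∉ S) → F.card ≤ c := by
    let P : ℕ → Prop := fun c =>
      ∃ F : Finset ℕ, (∀ a ∈ F, ∀ b ∈ F, a < b → b - a ∉ S) ∧ F.card = c
    have hP0 : P 0 := ⟨∅, by simp, rfl⟩
    refine ⟨Nat.findGreatest P q, Nat.findGreatest_spec (P := P) (Nat.zero_le q) hP0,
      fun F hF => Nat.le_findGreatest (hbound F hF) ⟨F, hF, rfl⟩⟩
  refine ⟨F.sup id + 1, fun k => ?_⟩
  set x := k + F.sup id + 1 with hx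
  have hle : ∀ a ∈ F, a ≤ F.sup id := fun a ha => Finset.le_sup (f := id) ha
  have hxF : x ∉ F := fun hmem => by
    have := hle x hmem
    omega
  by_contra! hcon
  have := hmax (insert x F) (by
    intro a ha b hb hab
    rw [Finset.mem_insert] at ha hb
    rcases ha with rfl | ha <;> rcases hb with rfl | hb
    · omega
    · have := hle b hb
      omega
    · have h1 := hle a ha
      have := hcon (F.sup id + 1 - a) (by omega)
      rwa [show k + (F.sup id + 1 - a) = x - a by omega] at this
    · exact hF a ha b hb hab)
  rw [Finset.card_insert_of_notMem hxF] at this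
  omega

/-- A sequence with controlled decrease that is uniformly summable along the differences of a set
with dense windows is summable. -/
theorem tsum_lt_top_of_tsum_differences_le {K : Set ℕ} {δ : ℝ} (hδ : 0 < δ) {A : Set ℕ}
    (hA : HasDenseWindows K δ A) {α : ℕ → ℝ≥0∞} {R C : ℝ≥0∞} (hR : R ≠ ∞) (hC : C ≠ ∞)
    (hα : ∀ k, α k ≤ R * α (k + 1))
    (hsum : ∀ n ∈ A, ∑' k, Set.indicator {k | 0 < k ∧ n + k ∈ A} α k ≤ C) :
    ∑' k, α k < ∞ := by
  classical
  choose M hM k _ hlt using hA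
  set B : ℕ → Finset ℕ := fun i => (finite_inter_Icc A (k i + 1) (k i + M i)).toFinset with hBdef
  have hBmem : ∀ i n, n ∈ B i ↔ n ∈ A ∧ n ∈ Set.Icc (k i + 1) (k i + M i) := fun i n => by
    simp [hBdef]
  have hBI : ∀ i, B i ⊆ Finset.Icc (k i + 1) (k i + M i) := fun i n hn => by
    rw [Finset.mem_Icc]
    exact ((hBmem i n).1 hn).2
  have hBcard : ∀ i, δ * M i < (B i).card := fun i => by
    rw [hBdef, ← Set.ncard_eq_toFinset_card _ (finite_inter_Icc A (k i + 1) (k i + M i))]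
    exact hlt i
  have hBle : ∀ i, (B i).card ≤ M i := fun i => by
    have := Finset.card_le_card (hBI i)
    rw [Nat.card_Icc] at this
    omega
  set U : Ultrafilter ℕ := hyperfilter ℕ
  have hMU : Tendsto M U atTop :=
    (tendsto_atTop_mono hM tendsto_id).mono_left Nat.hyperfilter_le_atTop
  obtain ⟨q, hq⟩ := exists_nat_gt (4 / δ)
  have hq0 : 0 < q := by
    have : (0 : ℝ) < q := lt_trans (by positivity) hq
    exact_mod_cast this
  have hq4 : 4 ≤ q * δ := by
    rw [div_lt_iff₀ hδ] at hq
    exact hq.le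
  set S : Set ℕ := {d | 0 < d ∧ ∀ᶠ i in (U : Filter ℕ),
    1 / (q : ℝ) ^ 2 * M i ≤ ((B i).filter fun n => n + d ∈ B i).card} with hS
  obtain ⟨G, hG⟩ : ∃ G : ℕ, ∀ k, ∃ g ≤ G, k + g ∈ S := by
    refine exists_syndetic (q := q) fun F hF => ?_
    obtain ⟨a, ha, b, hb, hab, hev⟩ := exists_difference_of_card hMU hBI hBcard hq4 hq0 hF
    exact ⟨a, ha, b, hb, hab, by omega, hev⟩
  -- the sum along `S` is finite
  have hSsum : ∑' d, S.indicator α d ≤ (q : ℝ≥0∞) ^ 2 * C := by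
    rw [ENNReal.tsum_eq_iSup_sum]
    refine iSup_le fun F => ?_
    have hev : ∀ᶠ i in (U : Filter ℕ), ∀ d ∈ F, d ∈ S →
        1 / (q : ℝ) ^ 2 * M i ≤ ((B i).filter fun n => n + d ∈ B i).card := by
      rw [Filter.eventually_all_finset]
      intro d _
      by_cases hd : d ∈ S
      · filter_upwards [hd.2] with i hi _ using hi
      · exact Filter.Eventually.of_forall fun i h => absurd h hd
    obtain ⟨i, hi, hMi⟩ := (hev.and (hMU.eventually_ge_atTop 1)).exists
    have hq' : (0 : ℝ) < q := by exact_mod_cast hq0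
    have hcard : ∀ d ∈ F, d ∈ S →
        (M i : ℝ≥0∞) ≤ (q : ℝ≥0∞) ^ 2 * ((B i).filter fun n => n + d ∈ B i).card := by
      intro d hd hdS
      have := hi d hd hdS
      rw [div_mul_eq_mul_div, one_mul, div_le_iff₀ (by positivity), mul_comm] at this
      exact_mod_cast this
    -- Double counting of pairs `(n, n + d)` in `B i`: each `d ∈ S` has at least `M i / q ^ 2` of
    -- them, while each `n` contributes at most `C`.
    have key : (M i : ℝ≥0∞) * ∑ d ∈ F, S.indicator α d ≤
        (M i : ℝ≥0∞) * ((q : ℝ≥0∞) ^ 2 * C) := by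
      calc (M i : ℝ≥0∞) * ∑ d ∈ F, S.indicator α d
          ≤ ∑ d ∈ F, (q : ℝ≥0∞) ^ 2 *
              ∑ n ∈ B i, Set.indicator {k | 0 < k ∧ n + k ∈ A} α d := by
            rw [Finset.mul_sum]
            refine Finset.sum_le_sum fun d hd => ?_
            by_cases hdS : d ∈ S
            · rw [Set.indicator_of_mem hdS]
              refine (mul_le_mul_left (hcard d hd hdS) _).trans ?_
              rw [mul_assoc]
              refine mul_le_mul_right ?_ _
              rw [← nsmul_eq_mul, ← Finset.sum_const, Finset.sum_filter]
              refine Finset.sum_le_sum fun n hn => ?_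
              split_ifs with hnd
              · rw [Set.indicator_of_mem]
                exact ⟨hdS.1, ((hBmem i _).1 hnd).1⟩
              · exact zero_le
            · rw [Set.indicator_of_notMem hdS, mul_zero]
              exact zero_le
        _ = (q : ℝ≥0∞) ^ 2 *
              ∑ n ∈ B i, ∑ d ∈ F, Set.indicator {k | 0 < k ∧ n + k ∈ A} α d := by
            rw [← Finset.mul_sum, Finset.sum_comm]
        _ ≤ (q : ℝ≥0∞) ^ 2 * ∑ n ∈ B i, C := by
            refine mul_le_mul_right (Finset.sum_le_sum fun n hn => ?_) _
            exact (ENNReal.sum_le_tsum F).trans (hsum n ((hBmem i n).1 hn).1)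
        _ ≤ (q : ℝ≥0∞) ^ 2 * ((M i : ℝ≥0∞) * C) := by
            rw [Finset.sum_const, nsmul_eq_mul]
            refine mul_le_mul_right (mul_le_mul_left ?_ _) _
            exact_mod_cast hBle i
        _ = (M i : ℝ≥0∞) * ((q : ℝ≥0∞) ^ 2 * C) := by ring
    refine (ENNReal.mul_le_mul_iff_right ?_ (ENNReal.natCast_ne_top _)).1 key
    exact_mod_cast (by omega : M i ≠ 0)
  have hpow : ∀ g k, α k ≤ R ^ g * α (k + g) := by
    intro g
    induction g with
    | zero => simp
    | succ g ih =>
      intro k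
      refine (ih k).trans ?_
      rw [pow_succ, mul_assoc]
      exact mul_le_mul_right (hα (k + g)) _
  calc ∑' k, α k ≤ ∑' k, ∑ g ∈ Finset.range (G + 1), R ^ g * S.indicator α (k + g) := by
        refine ENNReal.tsum_le_tsum fun k => ?_
        obtain ⟨g, hg, hgS⟩ := hG k
        refine (hpow g k).trans ?_
        rw [← Set.indicator_of_mem hgS α]
        exact Finset.single_le_sum (f := fun g => R ^ g * S.indicator α (k + g))
          (fun _ _ => zero_le) (Finset.mem_range.2 (by omega))
    _ = ∑ g ∈ Finset.range (G + 1), R ^ g * ∑' k, S.indicator α (k + g) := by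
        rw [Summable.tsum_finsetSum fun _ _ => ENNReal.summable]
        simp_rw [ENNReal.tsum_mul_left]
    _ ≤ ∑ g ∈ Finset.range (G + 1), R ^ g * ((q : ℝ≥0∞) ^ 2 * C) := by
        refine Finset.sum_le_sum fun g _ => mul_le_mul_right ?_ _
        exact (ENNReal.tsum_comp_le_tsum_of_injective (add_left_injective g) _).trans hSsum
    _ < ∞ := by
        refine ENNReal.sum_lt_top.2 fun g _ => ?_
        exact ENNReal.mul_lt_top (ENNReal.pow_lt_top hR.lt_top)
          (ENNReal.mul_lt_top (ENNReal.pow_lt_top (ENNReal.natCast_lt_top q)) hC.lt_top)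

section Sequences

variable {𝕜 : Type*} [RCLike 𝕜]

/-! ### The `ℓ^p` norm through sums in `[0, ∞]` -/

theorem exponent_pos {p : ℝ≥0∞} [hp1 : Fact (1 ≤ p)] (hp : p ≠ ∞) : 0 < p.toReal :=
  ENNReal.toReal_pos (zero_lt_one.trans_le hp1.out).ne' hp

theorem enorm_rpow_eq_ofReal {r : ℝ} (hr : 0 ≤ r) (c : 𝕜) :
    ‖c‖ₑ ^ r = ENNReal.ofReal (‖c‖ ^ r) := by
  rw [← ofReal_norm, ENNReal.ofReal_rpow_of_nonneg (norm_nonneg _) hr]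

theorem memℓp_of_tsum_enorm_lt_top {p : ℝ≥0∞} [Fact (1 ≤ p)] (hp : p ≠ ∞) {f : ℕ → 𝕜}
    (hf : ∑' i, ‖f i‖ₑ ^ p.toReal < ∞) : Memℓp f p := by
  have hp0 := exponent_pos hp
  refine memℓp_gen ?_
  simp_rw [enorm_rpow_eq_ofReal hp0.le] at hf
  refine (ENNReal.summable_toReal hf.ne).congr fun i => ?_
  rw [ENNReal.toReal_ofReal (by positivity)]

theorem tsum_enorm_rpow_eq {p : ℝ≥0∞} [Fact (1 ≤ p)] (hp : p ≠ ∞)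
    (x : lp (fun _ : ℕ => 𝕜) p) :
    ∑' i, ‖x i‖ₑ ^ p.toReal = ENNReal.ofReal (‖x‖ ^ p.toReal) := by
  have hp0 := exponent_pos hp
  simp_rw [enorm_rpow_eq_ofReal hp0.le]
  rw [← ENNReal.ofReal_tsum_of_nonneg (fun i => by positivity) (lp.hasSum_norm hp0 x).summable,
    (lp.hasSum_norm hp0 x).tsum_eq]

theorem norm_le_of_tsum_enorm_le {p : ℝ≥0∞} [Fact (1 ≤ p)] (hp : p ≠ ∞)
    {x : lp (fun _ : ℕ => 𝕜) p} {C : ℝ} (hC : 0 ≤ C)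
    (h : ∑' i, ‖x i‖ₑ ^ p.toReal ≤ ENNReal.ofReal (C ^ p.toReal)) : ‖x‖ ≤ C := by
  rw [tsum_enorm_rpow_eq hp, ENNReal.ofReal_le_ofReal_iff (by positivity)] at h
  exact (Real.rpow_le_rpow_iff (lp.norm_nonneg' x) hC (exponent_pos hp)).1 h

theorem tsum_enorm_rpow_le {p : ℝ≥0∞} [Fact (1 ≤ p)] (hp : p ≠ ∞)
    {x : lp (fun _ : ℕ => 𝕜) p} {C : ℝ} (h : ‖x‖ ≤ C) :
    ∑' i, ‖x i‖ₑ ^ p.toReal ≤ ENNReal.ofReal (C ^ p.toReal) := by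
  rw [tsum_enorm_rpow_eq hp]
  exact ENNReal.ofReal_le_ofReal
    (Real.rpow_le_rpow (lp.norm_nonneg' x) h (exponent_pos hp).le)

/-- The finitely supported vector with coordinates `a 0, …, a (l - 1)`. -/
noncomputable def finVec (p : ℝ≥0∞) {l : ℕ} (a : Fin l → 𝕜) : lp (fun _ : ℕ => 𝕜) p :=
  ∑ j : Fin l, lp.single (E := fun _ : ℕ => 𝕜) p (j : ℕ) (a j)

theorem finVec_apply {p : ℝ≥0∞} {l : ℕ} (a : Fin l → 𝕜) (i : ℕ) :
    finVec p a i = if h : i < l then a ⟨i, h⟩ else 0 := by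
  rw [finVec, lp.coeFn_sum, Finset.sum_apply]
  simp_rw [lp.single_apply]
  split_ifs with h
  · rw [Finset.sum_eq_single ⟨i, h⟩]
    · simp
    · intro j _ hj
      exact Pi.single_eq_of_ne (fun hij => hj (Fin.ext hij.symm)) _
    · simp
  · refine Finset.sum_eq_zero fun j _ => Pi.single_eq_of_ne (fun hij => ?_) _
    exact h (hij ▸ j.2)

theorem norm_finVec_le {p : ℝ≥0∞} [Fact (1 ≤ p)] {l : ℕ} (a : Fin l → 𝕜) {c : ℝ}
    (h : ∀ j, ‖a j‖ ≤ c) : ‖finVec p a‖ ≤ l * c := by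
  have hp0 : 0 < p := zero_lt_one.trans_le Fact.out
  refine (norm_sum_le _ _).trans ((Finset.sum_le_card_nsmul _ _ c fun j _ => ?_).trans ?_)
  · rw [lp.norm_single hp0]
    exact h j
  · simp

theorem tendsto_finVec {p : ℝ≥0∞} [Fact (1 ≤ p)] (hp : p ≠ ∞) (x : lp (fun _ : ℕ => 𝕜) p) :
    Tendsto (fun l : ℕ => finVec p fun j : Fin l => x j) atTop (𝓝 x) := by
  refine (lp.hasSum_single hp x).tendsto_sum_nat.congr fun l => ?_
  exact (Fin.sum_univ_eq_sum_range (fun i => lp.single (E := fun _ : ℕ => 𝕜) p i (x i)) l).symm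

theorem separableSpace_lp {p : ℝ≥0∞} [Fact (1 ≤ p)] (hp : p ≠ ∞) :
    TopologicalSpace.SeparableSpace (lp (fun _ : ℕ => 𝕜) p) := by
  rw [← TopologicalSpace.isSeparable_univ_iff]
  have h : TopologicalSpace.IsSeparable (⋃ l : ℕ, Set.range fun a : Fin l → 𝕜 => finVec p a) := by
    refine TopologicalSpace.IsSeparable.iUnion fun l => TopologicalSpace.isSeparable_range ?_
    refine continuous_finsetSum _ fun j _ => ?_
    exact (lp.isometry_single (E := fun _ : ℕ => 𝕜) (j : ℕ)).continuous.comp (continuous_apply j)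
  refine h.closure.mono fun x _ => mem_closure_of_tendsto (tendsto_finVec hp x) ?_
  exact Eventually.of_forall fun l => Set.mem_iUnion.2 ⟨l, _, rfl⟩

/-- Finitely many vectors of `ℓ^p` are approximated by vectors with support exactly
`{0, …, l - 1}`. -/
theorem exists_finVec_near {p : ℝ≥0∞} [Fact (1 ≤ p)] (hp : p ≠ ∞) {N : ℕ}
    (y : Fin N → lp (fun _ : ℕ => 𝕜) p) {η : ℝ} (hη : 0 < η) :
    ∃ l : ℕ, 1 ≤ l ∧ ∃ a : Fin N → Fin l → 𝕜, (∀ s j, a s j ≠ 0) ∧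
      ∀ s, ‖finVec p (a s) - y s‖ < η := by
  have hev : ∀ᶠ l : ℕ in atTop, ∀ s, ‖(finVec p fun j : Fin l => y s j) - y s‖ < η / 2 := by
    rw [Filter.eventually_all]
    intro s
    have := Metric.tendsto_nhds.1 (tendsto_finVec hp (y s)) (η / 2) (by positivity)
    simpa only [dist_eq_norm] using this
  obtain ⟨l, hl, hl1⟩ := (hev.and (eventually_ge_atTop 1)).exists
  have hl0 : (0 : ℝ) < l := by exact_mod_cast hl1
  -- Vanishing coordinates are replaced by `c`, which moves the vector by at most `l * c = η / 2`.
  set c : ℝ := η / (2 * l) with hc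
  have hc0 : 0 < c := by positivity
  refine ⟨l, hl1, fun s j => if y s j = 0 then (c : 𝕜) else y s j, fun s j => ?_, fun s => ?_⟩
  · dsimp only
    split_ifs with h
    · exact_mod_cast hc0.ne'
    · exact h
  · have h1 : finVec p (fun j : Fin l => if y s j = 0 then (c : 𝕜) else y s j) -
        (finVec p fun j : Fin l => y s j) =
        finVec p fun j : Fin l => (if y s j = 0 then (c : 𝕜) else y s j) - y s j := by
      simp only [finVec, ← Finset.sum_sub_distrib, lp.single_sub]
    have h2 : ‖finVec p fun j : Fin l => (if y s j = 0 then (c : 𝕜) else y s j) - y s j‖ ≤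
        l * c := by
      refine norm_finVec_le _ fun j => ?_
      split_ifs with h
      · simp [h, abs_of_pos hc0]
      · simpa using hc0.le
    have h3 : (l : ℝ) * c = η / 2 := by
      rw [hc]
      field_simp
    calc _ ≤ _ := norm_sub_le_norm_sub_add_norm_sub _ (finVec p fun j : Fin l => y s j) _
      _ < η / 2 + η / 2 := by
        rw [h1]
        exact add_lt_add_of_le_of_lt (h2.trans h3.le) (hl s)
      _ = η := add_halves η

/-! ### Weight products and powers of weighted shifts -/

theorem weightProd_zero (w : ℕ → 𝕜) (j : ℕ) : weightProd w j 0 = 1 := by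
  simp [weightProd]

theorem weightProd_eq_prod_range (w : ℕ → 𝕜) (j n : ℕ) :
    weightProd w j n = ∏ ν ∈ Finset.range n, w (j + 1 + ν) := by
  rw [weightProd, ← Finset.Ico_add_one_right_eq_Icc, Finset.prod_Ico_eq_prod_range]
  refine Finset.prod_congr (by simp) fun ν _ => ?_
  congr 1
  omega

theorem weightProd_add (w : ℕ → 𝕜) (j k m : ℕ) :
    weightProd w j (k + m) = weightProd w j k * weightProd w (j + k) m := by
  simp only [weightProd_eq_prod_range, Finset.prod_range_add]
  congr 1
  refine Finset.prod_congr rfl fun ν _ => ?_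
  congr 1
  omega

theorem weightProd_one (w : ℕ → 𝕜) (j : ℕ) : weightProd w j 1 = w (j + 1) := by
  simp [weightProd]

theorem weightedShift_pow_apply {p : ℝ≥0∞} [Fact (1 ≤ p)] {w : ℕ → 𝕜}
    (hw : BddAbove (Set.range fun n => ‖w n‖)) (x : lp (fun _ : ℕ => 𝕜) p) (n i : ℕ) :
    (weightedShift p w hw ^ n) x i = weightProd w i n * x (i + n) := by
  induction n generalizing i with
  | zero => simp [weightProd_zero]
  | succ n ih =>
    rw [pow_succ', mul_apply_eq_comp, weightedShift_apply, ih, add_comm n 1,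
      weightProd_add, weightProd_one, mul_assoc, add_assoc]

theorem piMap_pow_apply {X : Type*} [NormedAddCommGroup X] [NormedSpace 𝕜 X] {N : ℕ}
    (T : Fin N → X →L[𝕜] X) (n : ℕ) (x : Fin N → X) :
    (ContinuousLinearMap.piMap T ^ n) x = fun s => (T s ^ n) (x s) := by
  induction n with
  | zero => simp
  | succ n ih =>
    rw [pow_succ', mul_apply_eq_comp, ih]
    funext s
    rw [pow_succ', mul_apply_eq_comp]
    rfl

end Sequences

theorem HasDenseWindows.exists_ge {K : Set ℕ} {δ : ℝ} {A : Set ℕ} (h : HasDenseWindows K δ A)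
    (hδ : 0 < δ) (n₀ : ℕ) : ∃ n ∈ A, n₀ ≤ n := by
  obtain ⟨M, -, k, -, hlt⟩ := h.inter_Ici hδ n₀ 0
  have hpos : 0 < ((A ∩ Set.Ici n₀) ∩ Set.Icc (k + 1) (k + M)).ncard := by
    have : (0 : ℝ) < ((A ∩ Set.Ici n₀) ∩ Set.Icc (k + 1) (k + M)).ncard :=
      lt_of_le_of_lt (by positivity) hlt
    exact_mod_cast this
  obtain ⟨n, hn⟩ := (Set.ncard_pos (finite_inter_Icc _ _ _)).1 hpos
  exact ⟨n, hn.1.1, hn.1.2⟩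

/-! ### Necessity: both conditions from the return times of one vector -/

section Necessity

variable {𝕜 : Type*} [RCLike 𝕜]

theorem one_div_enorm_rpow_le {r : ℝ} (hr : 0 ≤ r) {a b : 𝕜} {c : ℝ} (hc : 0 < c)
    (h : c ≤ ‖a * b‖) :
    1 / ‖a‖ₑ ^ r ≤ ENNReal.ofReal ((1 / c) ^ r) * ‖b‖ₑ ^ r := by
  have hab : a * b ≠ 0 := norm_pos_iff.1 (hc.trans_le h)
  have ha : 0 < ‖a‖ := norm_pos_iff.2 (left_ne_zero_of_mul hab)
  rw [enorm_rpow_eq_ofReal hr, enorm_rpow_eq_ofReal hr, ← ENNReal.ofReal_mul (by positivity),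
    ← ENNReal.ofReal_one, ← ENNReal.ofReal_div_of_pos (by positivity)]
  refine ENNReal.ofReal_le_ofReal ?_
  rw [← Real.mul_rpow (by positivity) (norm_nonneg _), div_le_iff₀ (by positivity),
    ← Real.mul_rpow (by positivity) (norm_nonneg _)]
  refine Real.one_le_rpow ?_ hr
  rw [norm_mul] at h
  rw [div_mul_eq_mul_div, div_mul_eq_mul_div, le_div_iff₀ hc]
  linarith

theorem norm_weightProd_mul_sub_lt {p : ℝ≥0∞} [Fact (1 ≤ p)] {w : ℕ → 𝕜}
    (hw : BddAbove (Set.range fun n => ‖w n‖)) {x y : lp (fun _ : ℕ => 𝕜) p} {n i : ℕ} {η : ℝ}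
    (h : ‖(weightedShift p w hw ^ n) x - y‖ < η) :
    ‖weightProd w i n * x (i + n) - y i‖ < η := by
  have hp0 : p ≠ 0 := (zero_lt_one.trans_le (Fact.out : 1 ≤ p)).ne'
  refine lt_of_le_of_lt ?_ h
  have := lp.norm_apply_le_norm hp0 ((weightedShift p w hw ^ n) x - y) i
  rwa [lp.coeFn_sub, Pi.sub_apply, weightedShift_pow_apply] at this

/-- The weights of a shift are summably inverse if some orbit returns to the ball of radius `1/2`
around `e 0` along a set with dense windows. -/
theorem tsum_one_div_weightProd_lt_top {p : ℝ≥0∞} [Fact (1 ≤ p)] (hp : p ≠ ∞) {w : ℕ → 𝕜}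
    (hw : BddAbove (Set.range fun n => ‖w n‖)) {x : lp (fun _ : ℕ => 𝕜) p} {K : Set ℕ} {δ : ℝ}
    (hδ : 0 < δ)
    (hA : HasDenseWindows K δ
      {n | ‖(weightedShift p w hw ^ n) x - lp.single p 0 (1 : 𝕜)‖ < 1 / 2}) (j : ℕ) :
    ∑' n, 1 / ‖weightProd w j (n + 1)‖ₑ ^ p.toReal < ∞ := by
  have hp0 := exponent_pos hp
  set e : lp (fun _ : ℕ => 𝕜) p := lp.single p 0 (1 : 𝕜) with he
  set A : Set ℕ := {n | ‖(weightedShift p w hw ^ n) x - e‖ < 1 / 2} with hAdef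
  have hhalf : ∀ n ∈ A, 1 / 2 ≤ ‖weightProd w 0 n * x n‖ := by
    intro n hn
    have h := norm_weightProd_mul_sub_lt hw (i := 0) hn
    rw [he, lp.single_apply_self, zero_add] at h
    have h1 := norm_sub_norm_le (1 : 𝕜) (1 - weightProd w 0 n * x n)
    rw [norm_sub_rev] at h
    rw [sub_sub_cancel, norm_one] at h1
    linarith
  -- `W_{0,k}` is a factor of `W_{0,n}` for every `n ≥ k`, and `A` is unbounded.
  have hne : ∀ k, weightProd w 0 k ≠ 0 := by
    intro k hk
    obtain ⟨n, hn, hkn⟩ := hA.exists_ge hδ k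
    have := hhalf n hn
    rw [← Nat.add_sub_cancel' hkn, weightProd_add, hk, zero_mul, zero_mul, norm_zero] at this
    norm_num at this
  set α : ℕ → ℝ≥0∞ := fun k => 1 / ‖weightProd w 0 k‖ₑ ^ p.toReal with hα
  have hαsum : ∑' k, α k < ∞ := by
    refine tsum_lt_top_of_tsum_differences_le hδ hA
      (R := ENNReal.ofReal ((⨆ n, ‖w n‖) ^ p.toReal))
      (C := ENNReal.ofReal ((1 / (1 / 2)) ^ p.toReal) * ENNReal.ofReal ((1 / 2) ^ p.toReal))
      ENNReal.ofReal_ne_top (ENNReal.mul_ne_top ENNReal.ofReal_ne_top ENNReal.ofReal_ne_top) ?_ ?_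
    · intro k
      have hwk : ‖w (k + 1)‖ₑ ^ p.toReal ≤ ENNReal.ofReal ((⨆ n, ‖w n‖) ^ p.toReal) := by
        rw [enorm_rpow_eq_ofReal hp0.le]
        exact ENNReal.ofReal_le_ofReal
          (Real.rpow_le_rpow (norm_nonneg _) (le_ciSup hw (k + 1)) hp0.le)
      have hmul : weightProd w 0 (k + 1) = weightProd w 0 k * w (k + 1) := by
        rw [weightProd_add, weightProd_one, zero_add]
      have hw0 : w (k + 1) ≠ 0 := right_ne_zero_of_mul (hmul ▸ hne (k + 1))
      have h0 : ‖w (k + 1)‖ₑ ^ p.toReal ≠ 0 := by simp [ENNReal.rpow_eq_zero_iff, hw0]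
      have ht : ‖w (k + 1)‖ₑ ^ p.toReal ≠ ∞ := ENNReal.rpow_ne_top_of_nonneg hp0.le enorm_ne_top
      refine le_trans (le_of_eq ?_) (mul_le_mul_left hwk _)
      simp only [hα]
      rw [hmul, enorm_mul, ENNReal.mul_rpow_of_nonneg _ _ hp0.le, one_div, one_div,
        ENNReal.mul_inv (Or.inr ht) (Or.inr h0), mul_left_comm, ENNReal.mul_inv_cancel h0 ht,
        mul_one]
    -- For `n` and `n + k` in `A`, `|W_{0,k}| * |W_{k,n} x_{n+k}| ≥ 1/2`, and the second factor is
    -- the modulus of the `k`-th coordinate of `T ^ n x - e`, a vector of norm below `1/2`.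
    · intro n hn
      have hn' : ∑' k, ‖((weightedShift p w hw ^ n) x - e) k‖ₑ ^ p.toReal ≤
          ENNReal.ofReal ((1 / 2) ^ p.toReal) := tsum_enorm_rpow_le hp (le_of_lt hn)
      refine le_trans ?_ (mul_le_mul_right hn' _)
      rw [← ENNReal.tsum_mul_left]
      refine ENNReal.tsum_le_tsum fun k => ?_
      by_cases hk : k ∈ {k | 0 < k ∧ n + k ∈ A}
      · rw [Set.indicator_of_mem hk]
        refine one_div_enorm_rpow_le hp0.le (by norm_num) ?_
        have hek : e k = 0 := lp.single_apply_ne _ _ _ hk.1.ne'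
        rw [lp.coeFn_sub, Pi.sub_apply, weightedShift_pow_apply, hek, sub_zero]
        have := hhalf _ hk.2
        rwa [add_comm n k, weightProd_add, zero_add, mul_assoc] at this
      · rw [Set.indicator_of_notMem hk]
        exact zero_le
  have hterm : ∀ n, 1 / ‖weightProd w j (n + 1)‖ₑ ^ p.toReal =
      ‖weightProd w 0 j‖ₑ ^ p.toReal * α (j + (n + 1)) := by
    intro n
    have h0 : ‖weightProd w 0 j‖ₑ ^ p.toReal ≠ 0 := by simp [ENNReal.rpow_eq_zero_iff, hne j]
    have ht : ‖weightProd w 0 j‖ₑ ^ p.toReal ≠ ∞ :=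
      ENNReal.rpow_ne_top_of_nonneg hp0.le enorm_ne_top
    simp only [hα]
    rw [weightProd_add w 0 j, zero_add, enorm_mul, ENNReal.mul_rpow_of_nonneg _ _ hp0.le, one_div,
      one_div, ENNReal.mul_inv (Or.inl h0) (Or.inl ht), ← mul_assoc,
      ENNReal.mul_inv_cancel h0 ht, one_mul]
  simp_rw [hterm]
  rw [ENNReal.tsum_mul_left]
  refine ENNReal.mul_lt_top (ENNReal.rpow_lt_top_of_nonneg hp0.le enorm_ne_top) ?_
  refine lt_of_le_of_lt (ENNReal.tsum_comp_le_tsum_of_injective (fun m n h => ?_) α) hαsum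
  simpa using h

theorem norm_div_sub_div_le {u v a b : 𝕜} {c D η : ℝ} (hc : 0 < c) (hη : η ≤ c / 2)
    (hb : c ≤ ‖b‖) (haD : ‖a‖ ≤ D) (hbD : ‖b‖ ≤ D) (hu : ‖u - a‖ < η) (hv : ‖v - b‖ < η) :
    ‖u / v - a / b‖ ≤ 4 * D * η / c ^ 2 := by
  have hη0 : 0 < η := (norm_nonneg _).trans_lt hu
  have hv' : c / 2 ≤ ‖v‖ := by
    have := norm_sub_norm_le b v
    rw [norm_sub_rev] at this
    linarith
  have hv0 : v ≠ 0 := norm_pos_iff.1 (by linarith)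
  have hb0 : b ≠ 0 := norm_pos_iff.1 (by linarith)
  have hD : 0 < D := by linarith
  rw [div_sub_div _ _ hv0 hb0, norm_div, norm_mul,
    show u * b - v * a = (u - a) * b - (v - b) * a by ring]
  have h1 : ‖(u - a) * b - (v - b) * a‖ ≤ η * D + η * D := by
    refine (norm_sub_le _ _).trans ?_
    rw [norm_mul, norm_mul]
    gcongr
  have h2 : c / 2 * c ≤ ‖v‖ * ‖b‖ := by gcongr
  calc _ ≤ (η * D + η * D) / (c / 2 * c) := by gcongr
    _ = 4 * D * η / c ^ 2 := by
      field_simp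
      ring

variable {p : ℝ≥0∞} [Fact (1 ≤ p)] {N : ℕ} {w : Fin N → ℕ → 𝕜}
  {hw : ∀ s, BddAbove (Set.range fun n => ‖w s n‖)}

theorem return_set_mem {𝒜 : Set (Set ℕ)} {x : lp (fun _ : ℕ => 𝕜) p}
    (h : IsHypercyclicVector 𝒜 (ContinuousLinearMap.piMap fun s => weightedShift p (w s) (hw s))
      fun _ => x) (y : Fin N → lp (fun _ : ℕ => 𝕜) p) {η : ℝ} (hη : 0 < η) :
    {n | ∀ s, ‖(weightedShift p (w s) (hw s) ^ n) x - y s‖ < η} ∈ 𝒜 := by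
  have := h {z | ∀ s, ‖z s - y s‖ < η} ?_ ⟨y, fun s => by simpa using hη⟩
  · simpa only [piMap_pow_apply, Set.mem_ofPred_eq] using this
  · rw [Set.ofPred_forall]
    exact isOpen_iInter_of_finite fun s => isOpen_lt (by fun_prop) continuous_const

theorem exists_ratio_set (hp : p ≠ ∞) {x : lp (fun _ : ℕ => 𝕜) p} {K : Set ℕ}
    (h : ∀ (y : Fin N → lp (fun _ : ℕ => 𝕜) p) (η : ℝ), 0 < η → ∃ δ > 0, HasDenseWindows K δ
      {n | ∀ s, ‖(weightedShift p (w s) (hw s) ^ n) x - y s‖ < η})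
    {l : ℕ} (hl : 1 ≤ l) {a : Fin N → Fin l → 𝕜} (ha : ∀ s j, a s j ≠ 0) {ε : ℝ} (hε : 0 < ε) :
    ∃ A : Set ℕ, (∃ δ > 0, HasDenseWindows K δ A) ∧ ∀ s t : Fin N, ∀ n ∈ A,
      (∀ j : Fin l,
        ∑' m : {m : ℕ // m ∈ A ∧ n < m},
          ‖weightProd (w s) (j + m - n) n‖ₑ ^ p.toReal /
            ‖weightProd (w t) j m‖ₑ ^ p.toReal ≤ ENNReal.ofReal ε) ∧
      (∀ j : Fin l,
        ‖weightProd (w s) j n / weightProd (w t) j n - a s j / a t j‖ ≤ ε) := by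
  have hp0 := exponent_pos hp
  obtain ⟨c, hc, hca⟩ : ∃ c > 0, ∀ s j, c ≤ ‖a s j‖ := by
    have : ∀ᶠ c in 𝓝[>] (0 : ℝ), ∀ s j, c ≤ ‖a s j‖ := by
      simp only [Filter.eventually_all]
      intro s j
      exact (eventually_le_nhds (norm_pos_iff.2 (ha s j))).filter_mono nhdsWithin_le_nhds
    obtain ⟨c, h1, h2⟩ := (this.and self_mem_nhdsWithin).exists
    exact ⟨c, h2, h1⟩
  obtain ⟨D, hD, hDa⟩ : ∃ D > 0, ∀ s j, ‖a s j‖ ≤ D := by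
    have : ∀ᶠ D in (atTop : Filter ℝ), ∀ s j, ‖a s j‖ ≤ D := by
      simp only [Filter.eventually_all]
      exact fun s j => eventually_ge_atTop _
    obtain ⟨D, h1, h2⟩ := (this.and (eventually_gt_atTop 0)).exists
    exact ⟨D, h2, h1⟩
  -- Chosen so that `(2 / c) ^ p * β ^ p = ε`, which gives (a). The other terms of `η` keep `|W x|`
  -- above `c / 2` and bound the error `4 * D * η / c ^ 2` in (b) by `ε`.
  set β : ℝ := c / 2 * ε ^ (1 / p.toReal) with hβ
  set η : ℝ := min (c / 2) (min β (ε * c ^ 2 / (4 * D))) with hη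
  have hη0 : 0 < η := by positivity
  have hηc : η ≤ c / 2 := min_le_left _ _
  have hηβ : η ≤ β := (min_le_right _ _).trans (min_le_left _ _)
  have hηε : η ≤ ε * c ^ 2 / (4 * D) := (min_le_right _ _).trans (min_le_right _ _)
  obtain ⟨δ, hδ, hA⟩ := h (fun s => finVec p (a s)) η hη0
  -- Distinct elements of one class differ by at least `l`, so `j + m - n` falls outside the support
  -- of the target vectors.
  obtain ⟨r, hr⟩ := hA.exists_residue hl
  have hcoord : ∀ n, (∀ s, ‖(weightedShift p (w s) (hw s) ^ n) x - finVec p (a s)‖ < η) →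
      ∀ s (j : Fin l), ‖weightProd (w s) j n * x (j + n) - a s j‖ < η := by
    intro n hn s j
    have := norm_weightProd_mul_sub_lt (hw s) (i := j) (hn s)
    rwa [finVec_apply, dif_pos j.2] at this
  have hlow : ∀ n, (∀ s, ‖(weightedShift p (w s) (hw s) ^ n) x - finVec p (a s)‖ < η) →
      ∀ s (j : Fin l), c / 2 ≤ ‖weightProd (w s) j n * x (j + n)‖ := by
    intro n hn s j
    have h1 := hcoord n hn s j
    have h2 := norm_sub_norm_le (a s j) (weightProd (w s) j n * x (j + n))
    rw [norm_sub_rev] at h2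
    have := hca s j
    linarith
  refine ⟨_, ⟨δ / l, by positivity, hr⟩, fun s t n hn => ⟨fun j => ?_, fun j => ?_⟩⟩
  · set v := (weightedShift p (w s) (hw s) ^ n) x - finVec p (a s) with hv
    have hvsum : ∑' i, ‖v i‖ₑ ^ p.toReal ≤ ENNReal.ofReal (β ^ p.toReal) :=
      tsum_enorm_rpow_le hp ((hn.1 s).le.trans hηβ)
    have hconst : ENNReal.ofReal ((1 / (c / 2)) ^ p.toReal) * ENNReal.ofReal (β ^ p.toReal) =
        ENNReal.ofReal ε := by
      rw [← ENNReal.ofReal_mul (by positivity), ← Real.mul_rpow (by positivity) (by positivity),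
        hβ, ← mul_assoc, one_div_mul_cancel (by positivity), one_mul, ← Real.rpow_mul hε.le,
        one_div_mul_cancel hp0.ne', Real.rpow_one]
    rw [← hconst]
    refine le_trans ?_ (mul_le_mul_right hvsum _)
    rw [← ENNReal.tsum_mul_left]
    refine le_trans (ENNReal.tsum_le_tsum fun m => ?_) (ENNReal.tsum_comp_le_tsum_of_injective
      (f := fun m : {m : ℕ // m ∈ _ ∧ n < m} => (j : ℕ) + m - n) (fun m m' hmm => ?_) _)
    · have hmn : l ≤ m - n := by
        have hmod : n ≡ m [MOD l] := hn.2.trans m.2.1.2.symm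
        exact Nat.le_of_dvd (Nat.sub_pos_of_lt m.2.2) ((Nat.modEq_iff_dvd' m.2.2.le).1 hmod)
      have hvi : v ((j : ℕ) + m - n) =
          weightProd (w s) ((j : ℕ) + m - n) n * x ((j : ℕ) + m) := by
        rw [hv, lp.coeFn_sub, Pi.sub_apply, weightedShift_pow_apply, finVec_apply,
          dif_neg (by omega), sub_zero, Nat.sub_add_cancel (by have := m.2.2; omega)]
      dsimp only
      rw [hvi, enorm_mul, ENNReal.mul_rpow_of_nonneg _ _ hp0.le, mul_left_comm, div_eq_mul_one_div]
      refine mul_le_mul_right (one_div_enorm_rpow_le hp0.le (by positivity) ?_) _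
      exact hlow m m.2.1.1 t j
    · have h1 := m.2.2
      have h2 := m'.2.2
      refine Subtype.ext ?_
      dsimp only at hmm
      omega
  · have hx : x (j + n) ≠ 0 := fun h0 => by
      have := hlow n hn.1 t j
      rw [h0, mul_zero, norm_zero] at this
      linarith
    -- All shifts act on the same `x`, so its coordinate `j + n` cancels in the quotient.
    rw [← mul_div_mul_right _ _ hx]
    refine (norm_div_sub_div_le hc hηc (hca t j) (hDa s j) (hDa t j) (hcoord n hn.1 s j)
      (hcoord n hn.1 t j)).trans ?_
    rw [le_div_iff₀ (by positivity)] at hηε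
    rw [div_le_iff₀ (by positivity)]
    linarith

end Necessity

/-! ### Sufficiency: explicit vectors with many visits -/

section Sufficiency

variable {𝕜 : Type*} [RCLike 𝕜] {p : ℝ≥0∞} [Fact (1 ≤ p)] {N : ℕ} {w : Fin N → ℕ → 𝕜}
  {hw : ∀ s, BddAbove (Set.range fun n => ‖w s n‖)}

theorem tsum_ne_top_of_succ {g : ℕ → ℝ≥0∞} (h0 : g 0 ≠ ∞) (h : ∑' n, g (n + 1) < ∞) :
    ∑' n, g n ≠ ∞ := by
  rw [tsum_eq_zero_add' ENNReal.summable]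
  exact ENNReal.add_ne_top.2 ⟨h0, h.ne⟩

theorem exists_tail_le {g : ℕ → ℝ≥0∞} (h : ∑' n, g n ≠ ∞) {ε : ℝ} (hε : 0 < ε) :
    ∀ᶠ n₀ : ℕ in atTop, ∑' k, g (k + n₀) ≤ ENNReal.ofReal ε :=
  (ENNReal.tendsto_sum_nat_add g h).eventually_le_const (ENNReal.ofReal_pos.2 hε)

theorem weightProd_ne_zero_of_tsum (hp : p ≠ ∞) {v : ℕ → 𝕜} {j : ℕ}
    (h : ∑' n, 1 / ‖weightProd v j (n + 1)‖ₑ ^ p.toReal < ∞) (n : ℕ) :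
    weightProd v j n ≠ 0 := by
  rcases n with _ | n
  · simp [weightProd_zero]
  · intro h0
    have := ENNReal.ne_top_of_tsum_ne_top h.ne n
    rw [h0, enorm_zero, ENNReal.zero_rpow_of_pos (exponent_pos hp)] at this
    simp at this

theorem tsum_one_div_ne_top {v : ℕ → 𝕜} {j : ℕ} {r : ℝ}
    (h : ∑' n, 1 / ‖weightProd v j (n + 1)‖ₑ ^ r < ∞) :
    ∑' n, 1 / ‖weightProd v j n‖ₑ ^ r ≠ ∞ :=
  tsum_ne_top_of_succ (g := fun n => 1 / ‖weightProd v j n‖ₑ ^ r)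
    (by simp [weightProd_zero]) h

/-- The sets of the second condition may be taken `l`-separated and such that the condition also
compares the reference shift `t` with itself. -/
theorem exists_separated_set (hp : p ≠ ∞)
    (h1 : ∀ (j : ℕ) (s : Fin N), ∑' n : ℕ, 1 / ‖weightProd (w s) j (n + 1)‖ₑ ^ p.toReal < ∞)
    {K : Set ℕ} {δ : ℝ} (hδ : 0 < δ) {A : Set ℕ} (hA : HasDenseWindows K δ A) {l : ℕ}
    {a : Fin N → Fin l → 𝕜} (ha : ∀ s j, a s j ≠ 0) {ε : ℝ} (hε : 0 < ε) {t : Fin N}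
    (hA' : ∀ s : Fin N, s ≠ t → ∀ n ∈ A,
      (∀ j : Fin l,
        ∑' m : {m : ℕ // m ∈ A ∧ n < m},
          ‖weightProd (w s) (j + m - n) n‖ₑ ^ p.toReal /
            ‖weightProd (w t) j m‖ₑ ^ p.toReal ≤ ENNReal.ofReal ε) ∧
      (∀ j : Fin l,
        ‖weightProd (w s) j n / weightProd (w t) j n - a s j / a t j‖ ≤ ε)) :
    ∃ B : Set ℕ, (∃ δ > 0, HasDenseWindows K δ B) ∧ (∀ m ∈ B, ∀ n ∈ B, m < n → m + l ≤ n) ∧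
      ∀ s : Fin N, ∀ n ∈ B, ∀ j : Fin l,
        (∑' m : {m : ℕ // m ∈ B ∧ n < m},
          ‖weightProd (w s) (j + m - n) n‖ₑ ^ p.toReal /
            ‖weightProd (w t) j m‖ₑ ^ p.toReal ≤ ENNReal.ofReal ε) ∧
        ‖weightProd (w s) j n / weightProd (w t) j n - a s j / a t j‖ ≤ ε := by
  have hp0 := exponent_pos hp
  have hev : ∀ᶠ n₀ : ℕ in atTop, ∀ j : Fin l,
      ∑' k, 1 / ‖weightProd (w t) j (k + n₀)‖ₑ ^ p.toReal ≤ ENNReal.ofReal ε :=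
    Filter.eventually_all.2 fun j => exists_tail_le (tsum_one_div_ne_top (h1 j t)) hε
  -- A gap `L` serves twice: it exceeds `l`, and the series of `1 / |W^t_{j,k}|^p` has tail at most
  -- `ε` from `L` on.
  obtain ⟨L, hL, hLl⟩ := (hev.and (eventually_ge_atTop (l + 1))).exists
  obtain ⟨r, hr⟩ := hA.exists_residue (L := L) (by omega)
  have hsep : ∀ m ∈ A ∩ {n | n % L = r}, ∀ n ∈ A ∩ {n | n % L = r}, m < n → m + L ≤ n := by
    intro m hm n hn hmn
    have hmod : m ≡ n [MOD L] := hm.2.trans hn.2.symm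
    have := Nat.le_of_dvd (Nat.sub_pos_of_lt hmn) ((Nat.modEq_iff_dvd' hmn.le).1 hmod)
    omega
  have hL0 : (0 : ℝ) < L := by exact_mod_cast (by omega : 0 < L)
  refine ⟨_, ⟨δ / L, by positivity, hr⟩, fun m hm n hn hmn => by
    have := hsep m hm n hn hmn
    omega, fun s n hn j => ?_⟩
  by_cases hst : s = t
  · subst hst
    refine ⟨?_, ?_⟩
    -- For `s = t` the quotient collapses to `1 / |W_{j,m-n}|^p`, with `m - n ≥ L`.
    · refine le_trans ?_ (hL j)
      refine le_trans (ENNReal.tsum_le_tsum fun m => ?_)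
        (ENNReal.tsum_comp_le_tsum_of_injective
          (f := fun m : {m : ℕ // m ∈ A ∩ {n | n % L = r} ∧ n < m} => (m : ℕ) - n - L)
          (fun m m' hmm => ?_) _)
      · have hm := hsep n hn m m.2.1 m.2.2
        have hne := weightProd_ne_zero_of_tsum hp (h1 ((j : ℕ) + m - n) s) n
        have h0 : ‖weightProd (w s) ((j : ℕ) + m - n) n‖ₑ ^ p.toReal ≠ 0 := by
          simp [ENNReal.rpow_eq_zero_iff, hne]
        have ht : ‖weightProd (w s) ((j : ℕ) + m - n) n‖ₑ ^ p.toReal ≠ ∞ :=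
          ENNReal.rpow_ne_top_of_nonneg hp0.le enorm_ne_top
        have hprod : weightProd (w s) j m =
            weightProd (w s) j (m - n) * weightProd (w s) ((j : ℕ) + m - n) n := by
          rw [show (j : ℕ) + m - n = j + (m - n) by omega, ← weightProd_add,
            Nat.sub_add_cancel (by omega)]
        rw [show (m : ℕ) - n - L + L = m - n by omega, hprod, enorm_mul,
          ENNReal.mul_rpow_of_nonneg _ _ hp0.le, div_eq_mul_inv,
          ENNReal.mul_inv (Or.inr ht) (Or.inr h0), mul_left_comm, ENNReal.mul_inv_cancel h0 ht,
          mul_one, one_div]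
      · have hm := hsep n hn m m.2.1 m.2.2
        have hm' := hsep n hn m' m'.2.1 m'.2.2
        refine Subtype.ext ?_
        dsimp only at hmm
        omega
    · rw [div_self (weightProd_ne_zero_of_tsum hp (h1 j s) n), div_self (ha s j), sub_self,
        norm_zero]
      exact hε.le
  · refine ⟨?_, (hA' s hst n hn.1).2 j⟩
    refine le_trans ?_ ((hA' s hst n hn.1).1 j)
    exact ENNReal.tsum_mono_subtype (s := {m | m ∈ A ∩ {n | n % L = r} ∧ n < m})
      (t := {m | m ∈ A ∧ n < m}) (fun m => ‖weightProd (w s) (j + m - n) n‖ₑ ^ p.toReal /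
            ‖weightProd (w t) j m‖ₑ ^ p.toReal) fun m hm => ⟨hm.1.1, hm.2⟩

open Classical in
/-- The coordinates `c / W_{j, n}` placed at `j + n` for `n ∈ B`. -/
noncomputable def blockSeq (v : ℕ → 𝕜) (B : Set ℕ) (j : ℕ) (c : 𝕜) (i : ℕ) : 𝕜 :=
  if j ≤ i ∧ i - j ∈ B then c / weightProd v j (i - j) else 0

theorem blockSeq_add (v : ℕ → 𝕜) {B : Set ℕ} (j : ℕ) (c : 𝕜) {n : ℕ} (hn : n ∈ B) :
    blockSeq v B j c (j + n) = c / weightProd v j n := by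
  rw [blockSeq, Nat.add_sub_cancel_left]
  exact if_pos ⟨Nat.le_add_right _ _, hn⟩

theorem exists_of_blockSeq_ne_zero {v : ℕ → 𝕜} {B : Set ℕ} {j : ℕ} {c : 𝕜} {i : ℕ}
    (h : blockSeq v B j c i ≠ 0) : ∃ n ∈ B, i = j + n := by
  rw [blockSeq] at h
  split_ifs at h with h'
  · exact ⟨i - j, h'.2, by omega⟩
  · exact absurd rfl h

theorem enorm_div_rpow {r : ℝ} (hr : 0 ≤ r) (c : 𝕜) {d : 𝕜} (hd : d ≠ 0) :
    ‖c / d‖ₑ ^ r = ‖c‖ₑ ^ r * (1 / ‖d‖ₑ ^ r) := by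
  rw [div_eq_mul_inv, enorm_mul, ENNReal.mul_rpow_of_nonneg _ _ hr, enorm_inv hd,
    ENNReal.inv_rpow, one_div]

theorem tsum_blockSeq_le (hp : p ≠ ∞) {v : ℕ → 𝕜} {j : ℕ} (hv : ∀ n, weightProd v j n ≠ 0)
    {B : Set ℕ} {n₀ : ℕ} (hB : ∀ n ∈ B, n₀ ≤ n) (c : 𝕜) :
    ∑' i, ‖blockSeq v B j c i‖ₑ ^ p.toReal ≤
      ‖c‖ₑ ^ p.toReal * ∑' k, 1 / ‖weightProd v j (k + n₀)‖ₑ ^ p.toReal := by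
  have hp0 := exponent_pos hp
  have hinj : Function.Injective fun k : ℕ => j + (k + n₀) := fun a b h => by simpa using h
  rw [← hinj.tsum_eq (f := fun i => ‖blockSeq v B j c i‖ₑ ^ p.toReal), ← ENNReal.tsum_mul_left]
  · refine ENNReal.tsum_le_tsum fun k => ?_
    rw [← enorm_div_rpow hp0.le c (hv _)]
    by_cases hk : k + n₀ ∈ B
    · rw [blockSeq_add v j c hk]
    · have h0 : blockSeq v B j c (j + (k + n₀)) = 0 := by
        by_contra hne
        obtain ⟨n, hn, hkn⟩ := exists_of_blockSeq_ne_zero hne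
        rw [Nat.add_left_cancel_iff] at hkn
        exact hk (hkn ▸ hn)
      rw [h0, enorm_zero, ENNReal.zero_rpow_of_pos hp0]
      exact zero_le
  · intro i hi
    have hne : blockSeq v B j c i ≠ 0 := fun h0 => hi (by
      simp only [h0, enorm_zero, ENNReal.zero_rpow_of_pos hp0])
    obtain ⟨n, hn, rfl⟩ := exists_of_blockSeq_ne_zero hne
    exact ⟨n - n₀, by
      have := hB n hn
      dsimp only
      omega⟩

theorem const_mul_rpow_le {r : ℝ} (hr : 0 ≤ r) {c : 𝕜} {D β : ℝ} (hc : ‖c‖ ≤ D) (hβ : 0 ≤ β) :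
    ‖c‖ₑ ^ r * ENNReal.ofReal (β ^ r) ≤ ENNReal.ofReal ((D * β) ^ r) := by
  have hD : 0 ≤ D := (norm_nonneg _).trans hc
  rw [Real.mul_rpow hD hβ, ENNReal.ofReal_mul (by positivity), enorm_rpow_eq_ofReal hr]
  gcongr

/-- The image under `T ^ n` of a block vector is close to a multiple of `e j`. -/
theorem norm_shift_pow_block_sub_le (hp : p ≠ ∞) {u v : ℕ → 𝕜}
    (hu : BddAbove (Set.range fun n => ‖u n‖)) {l : ℕ} {j : Fin l}
    (hv : ∀ n, weightProd v j n ≠ 0) {B : Set ℕ}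
    (hsep : ∀ m ∈ B, ∀ n ∈ B, m < n → m + l ≤ n) {b c : 𝕜} (hc : c ≠ 0) {D β : ℝ}
    (hcD : ‖c‖ ≤ D) (hβ : 0 < β) {n : ℕ} (hn : n ∈ B)
    (hsum : ∑' m : {m : ℕ // m ∈ B ∧ n < m},
      ‖weightProd u (j + m - n) n‖ₑ ^ p.toReal / ‖weightProd v j m‖ₑ ^ p.toReal ≤
        ENNReal.ofReal (β ^ p.toReal))
    (hratio : ‖weightProd u j n / weightProd v j n - b / c‖ ≤ β)
    {z : lp (fun _ : ℕ => 𝕜) p} (hz : ∀ i, z i = blockSeq v B j c i) :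
    ‖(weightedShift p u hu ^ n) z - lp.single p (j : ℕ) b‖ ≤ 2 * (D * β) := by
  have hp0 := exponent_pos hp
  have hp0' : 0 < p := zero_lt_one.trans_le Fact.out
  have hD : 0 ≤ D := (norm_nonneg _).trans hcD
  -- `d` is the exact `j`-th coordinate of the image: its distance to `b` is governed by `hratio`,
  -- the remaining coordinates `y` by `hsum`.
  set d : 𝕜 := weightProd u j n * (c / weightProd v j n) with hd
  set y : lp (fun _ : ℕ => 𝕜) p :=
    (weightedShift p u hu ^ n) z - lp.single p (j : ℕ) d with hy
  have hyj : y j = 0 := by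
    rw [hy, lp.coeFn_sub, Pi.sub_apply, weightedShift_pow_apply, lp.single_apply_self, hz,
      blockSeq_add v j c hn, hd, sub_self]
  have hyi : ∀ i, i ≠ (j : ℕ) → y i = weightProd u i n * blockSeq v B j c (i + n) := by
    intro i hi
    rw [hy, lp.coeFn_sub, Pi.sub_apply, weightedShift_pow_apply, lp.single_apply_ne _ _ _ hi, hz,
      sub_zero]
  have hynorm : ‖y‖ ≤ D * β := by
    refine norm_le_of_tsum_enorm_le hp (by positivity) ?_
    refine le_trans ?_ (const_mul_rpow_le hp0.le hcD hβ.le)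
    refine le_trans ?_ (mul_le_mul_right hsum _)
    have hinj : Function.Injective
        fun m : {m : ℕ // m ∈ B ∧ n < m} => (j : ℕ) + m - n := by
      intro m m' h
      have h1 := m.2.2
      have h2 := m'.2.2
      refine Subtype.ext ?_
      dsimp only at h
      omega
    rw [← hinj.tsum_eq (f := fun i => ‖y i‖ₑ ^ p.toReal), ← ENNReal.tsum_mul_left]
    · refine ENNReal.tsum_le_tsum fun m => ?_
      have hm := m.2.2
      rw [hyi _ (by omega), Nat.sub_add_cancel (by omega), blockSeq_add v j c m.2.1, enorm_mul,
        ENNReal.mul_rpow_of_nonneg _ _ hp0.le, enorm_div_rpow hp0.le c (hv _), mul_left_comm,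
        ← div_eq_mul_one_div]
    · intro i hi
      have hyne : y i ≠ 0 := fun h0 => hi (by
        simp only [h0, enorm_zero, ENNReal.zero_rpow_of_pos hp0])
      have hij : i ≠ (j : ℕ) := fun h => hyne (h ▸ hyj)
      rw [hyi i hij] at hyne
      obtain ⟨m, hm, him⟩ := exists_of_blockSeq_ne_zero (right_ne_zero_of_mul hyne)
      -- If `m < n`, separation and `j < l` give `j + m < n`, so that term has been shifted away; `m
      -- = n` would give `i = j`.
      have hnm : n < m := by
        by_contra hle
        have := hsep m hm n hn (by omega)
        omega
      exact ⟨⟨m, hm, hnm⟩, by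
        dsimp only
        omega⟩
  have hdb : ‖d - b‖ ≤ D * β := by
    have : d - b = c * (weightProd u j n / weightProd v j n - b / c) := by
      rw [hd]
      field_simp
    rw [this, norm_mul]
    gcongr
  have hsplit : (weightedShift p u hu ^ n) z - lp.single p (j : ℕ) b =
      y + lp.single p (j : ℕ) (d - b) := by
    rw [hy, lp.single_sub]
    abel
  rw [hsplit]
  refine (norm_add_le _ _).trans ?_
  rw [lp.norm_single hp0']
  linarith

theorem shift_pow_finVec_eq_zero {v : ℕ → 𝕜} (hv : BddAbove (Set.range fun n => ‖v n‖)) {l n : ℕ}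
    (a : Fin l → 𝕜) (hn : l ≤ n) : (weightedShift p v hv ^ n) (finVec p a) = 0 := by
  ext i
  rw [weightedShift_pow_apply, finVec_apply, dif_neg (by omega), mul_zero]
  rfl

/-- Every open set is visited with a fixed window density by a dense set of diagonal orbits. -/
theorem exists_dense_visits (hp : p ≠ ∞) (t : Fin N) {K : Set ℕ}
    (h1 : ∀ (j : ℕ) (s : Fin N), ∑' n : ℕ, 1 / ‖weightProd (w s) j (n + 1)‖ₑ ^ p.toReal < ∞)
    (h2 : ∀ l : ℕ, 1 ≤ l → ∀ a : Fin N → Fin l → 𝕜, (∀ s j, a s j ≠ 0) → ∀ ε : ℝ, 0 < ε →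
      ∃ A, (∃ δ > 0, HasDenseWindows K δ A) ∧ ∀ s : Fin N, s ≠ t → ∀ n ∈ A,
        (∀ j : Fin l,
          ∑' m : {m : ℕ // m ∈ A ∧ n < m},
            ‖weightProd (w s) (j + m - n) n‖ₑ ^ p.toReal /
              ‖weightProd (w t) j m‖ₑ ^ p.toReal ≤ ENNReal.ofReal ε) ∧
        (∀ j : Fin l,
          ‖weightProd (w s) j n / weightProd (w t) j n - a s j / a t j‖ ≤ ε))
    {V : Set (Fin N → lp (fun _ : ℕ => 𝕜) p)} (hV : IsOpen V) (hVne : V.Nonempty) :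
    ∃ δ > 0, ∀ O : Set (lp (fun _ : ℕ => 𝕜) p), IsOpen O → O.Nonempty →
      ∃ x ∈ O, HasDenseWindows K δ {n | (fun s => (weightedShift p (w s) (hw s) ^ n) x) ∈ V} := by
  have hp0 := exponent_pos hp
  obtain ⟨y, hyV⟩ := hVne
  obtain ⟨η, hη, hball⟩ := Metric.isOpen_iff.1 hV y hyV
  obtain ⟨l, hl, a, ha, hay⟩ := exists_finVec_near hp y (half_pos hη)
  have hl0 : (0 : ℝ) < l := by exact_mod_cast hl
  obtain ⟨D, hD, hDa⟩ : ∃ D > 0, ∀ j, ‖a t j‖ ≤ D := by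
    have : ∀ᶠ D in (atTop : Filter ℝ), ∀ j, ‖a t j‖ ≤ D :=
      Filter.eventually_all.2 fun j => eventually_ge_atTop _
    obtain ⟨D, h1, h2⟩ := (this.and (eventually_gt_atTop 0)).exists
    exact ⟨D, h2, h1⟩
  -- Each of the `l` blocks costs `2 * D * β`, in total `η / 4`. Below, `min β (β ^ p.toReal)` is
  -- used because (b) is linear while (a) bounds `p`-th powers.
  set β : ℝ := η / (8 * l * D) with hβ
  have hβ0 : 0 < β := by positivity
  obtain ⟨A, ⟨δ', hδ', hA⟩, hA'⟩ := h2 l hl a ha (min β (β ^ p.toReal)) (by positivity)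
  obtain ⟨B, ⟨δ, hδ, hB⟩, hsep, hB'⟩ :=
    exists_separated_set hp h1 hδ' hA ha (by positivity) hA'
  -- The density is fixed before `O` appears; only the truncation point `n₀` of `B` will depend on
  -- `O`.
  refine ⟨δ / 2, by positivity, fun O hO ⟨u₀, hu₀⟩ => ?_⟩
  obtain ⟨ρ, hρ, hballO⟩ := Metric.isOpen_iff.1 hO u₀ hu₀
  obtain ⟨l', -, a', -, hu⟩ := exists_finVec_near hp (fun _ : Fin 1 => u₀) (half_pos hρ)
  set u := finVec p (a' 0) with hudef
  set γ : ℝ := ρ / (4 * l * D) with hγ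
  have hγ0 : 0 < γ := by positivity
  have htail : ∀ᶠ n₀ : ℕ in atTop, ∀ j : Fin l,
      ∑' k, 1 / ‖weightProd (w t) j (k + n₀)‖ₑ ^ p.toReal ≤ ENNReal.ofReal (γ ^ p.toReal) :=
    Filter.eventually_all.2 fun j =>
      exists_tail_le (tsum_one_div_ne_top (h1 j t)) (by positivity)
  -- Starting at `n₀` makes the blocks of total norm at most `ρ / 4`, and `n₀ ≥ l'` makes every
  -- visit time annihilate `u`.
  obtain ⟨n₀, hn₀, hn₀l⟩ := (htail.and (eventually_ge_atTop l')).exists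
  set B₀ := B ∩ Set.Ici n₀ with hB₀
  have hne : ∀ j n, weightProd (w t) j n ≠ 0 := fun j => weightProd_ne_zero_of_tsum hp (h1 j t)
  have hblock : ∀ j : Fin l, ∑' i, ‖blockSeq (w t) B₀ j (a t j) i‖ₑ ^ p.toReal ≤
      ENNReal.ofReal ((D * γ) ^ p.toReal) := fun j =>
    (tsum_blockSeq_le hp (hne j) (fun n hn => hn.2) _).trans
      ((mul_le_mul_right (hn₀ j) _).trans (const_mul_rpow_le hp0.le (hDa j) hγ0.le))
  set z : Fin l → lp (fun _ : ℕ => 𝕜) p := fun j =>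
    ⟨fun i => blockSeq (w t) B₀ j (a t j) i,
      memℓp_of_tsum_enorm_lt_top hp ((hblock j).trans_lt ENNReal.ofReal_lt_top)⟩ with hz
  have hznorm : ∀ j, ‖z j‖ ≤ D * γ := fun j =>
    norm_le_of_tsum_enorm_le hp (by positivity) (hblock j)
  refine ⟨u + ∑ j, z j, hballO ?_, (hB.inter_Ici hδ n₀).mono ?_⟩
  · have hsum : ‖∑ j, z j‖ ≤ ρ / 4 := by
      refine (norm_sum_le _ _).trans ((Finset.sum_le_card_nsmul _ _ _ fun j _ => hznorm j).trans ?_)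
      rw [Finset.card_univ, Fintype.card_fin, nsmul_eq_mul, hγ]
      exact le_of_eq (by field_simp)
    rw [mem_ball_iff_norm, add_sub_right_comm]
    have := hu 0
    refine (norm_add_le _ _).trans_lt ?_
    linarith
  · intro n hn
    have hn₀n : n₀ ≤ n := hn.2
    refine hball ?_
    rw [Metric.mem_ball, dist_pi_lt_iff hη]
    intro s
    have hkey : ∀ j : Fin l,
        ‖(weightedShift p (w s) (hw s) ^ n) (z j) - lp.single p (j : ℕ) (a s j)‖ ≤
          2 * (D * β) := by
      intro j
      refine norm_shift_pow_block_sub_le hp (hw s) (hne j)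
        (fun m hm m' hm' => hsep m hm.1 m' hm'.1) (ha t j) (hDa j) hβ0 hn ?_
        (((hB' s n hn.1 j).2).trans (min_le_left _ _)) fun i => rfl
      refine le_trans ?_ (((hB' s n hn.1 j).1).trans
        (ENNReal.ofReal_le_ofReal (min_le_right _ _)))
      exact ENNReal.tsum_mono_subtype (s := {m | m ∈ B ∩ Set.Ici n₀ ∧ n < m})
        (t := {m | m ∈ B ∧ n < m}) (fun m => ‖weightProd (w s) (j + m - n) n‖ₑ ^ p.toReal /
            ‖weightProd (w t) j m‖ₑ ^ p.toReal) fun m hm => ⟨hm.1.1, hm.2⟩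
    have heq : (weightedShift p (w s) (hw s) ^ n) (u + ∑ j, z j) - finVec p (a s) =
        ∑ j, ((weightedShift p (w s) (hw s) ^ n) (z j) - lp.single p (j : ℕ) (a s j)) := by
      rw [map_add, hudef, shift_pow_finVec_eq_zero (hw s) _ (hn₀l.trans hn₀n), zero_add, map_sum,
        finVec, ← Finset.sum_sub_distrib]
    have hsum : ‖(weightedShift p (w s) (hw s) ^ n) (u + ∑ j, z j) - finVec p (a s)‖ ≤ η / 4 := by
      rw [heq]
      refine (norm_sum_le _ _).trans ((Finset.sum_le_card_nsmul _ _ _ fun j _ => hkey j).trans ?_)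
      rw [Finset.card_univ, Fintype.card_fin, nsmul_eq_mul, hβ]
      refine le_of_eq ?_
      field_simp
      norm_num
    rw [dist_eq_norm]
    have := hay s
    refine (norm_sub_le_norm_sub_add_norm_sub _ (finVec p (a s)) _).trans_lt ?_
    linarith

end Sufficiency

/-! ### Baire category: one vector for all open sets -/

section Baire

variable {𝕜 X : Type*} [RCLike 𝕜] [NormedAddCommGroup X] [NormedSpace 𝕜 X]

/-- A window contains finitely many times, and each visit to the open set `V` persists near `x`; so
the count cannot drop locally. -/
theorem isOpen_window_visits {Y : Type*} [TopologicalSpace Y] {f : ℕ → X → Y}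
    (hf : ∀ n, Continuous (f n)) {V : Set Y} (hV : IsOpen V) (c : ℝ) (k M : ℕ) :
    IsOpen {x | c < (({n | f n x ∈ V} ∩ Set.Icc (k + 1) (k + M)).ncard : ℝ)} := by
  rw [isOpen_iff_mem_nhds]
  intro x hx
  have hev : ∀ᶠ x' in 𝓝 x, ∀ n ∈ {n | f n x ∈ V} ∩ Set.Icc (k + 1) (k + M), f n x' ∈ V :=
    (Filter.eventually_all_finite (finite_inter_Icc _ _ _)).2 fun n hn =>
      (hf n).continuousAt.eventually_mem (hV.mem_nhds hn.1)
  filter_upwards [hev] with x' hx'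
  have hsub : {n | f n x ∈ V} ∩ Set.Icc (k + 1) (k + M) ⊆
      {n | f n x' ∈ V} ∩ Set.Icc (k + 1) (k + M) := fun n hn => ⟨hx' n hn, hn.2⟩
  refine lt_of_lt_of_le hx ?_
  exact_mod_cast Set.ncard_le_ncard hsub (finite_inter_Icc _ _ _)

/-- A Baire category criterion: if every open set is visited with a fixed window density by a dense
set of diagonal orbits, then some diagonal orbit visits every open set along dense windows. -/
theorem exists_vector_of_dense_visits [CompleteSpace X] [SecondCountableTopology X] {N : ℕ}
    (T : Fin N → X →L[𝕜] X) {K : Set ℕ}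
    (h : ∀ V : Set (Fin N → X), IsOpen V → V.Nonempty → ∃ δ > 0, ∀ O : Set X, IsOpen O →
      O.Nonempty → ∃ x ∈ O, HasDenseWindows K δ {n | (fun s => (T s ^ n) x) ∈ V}) :
    ∃ x : X, ∀ V : Set (Fin N → X), IsOpen V → V.Nonempty →
      ∃ δ > 0, HasDenseWindows K δ {n | (fun s => (T s ^ n) x) ∈ V} := by
  let 𝓑 := TopologicalSpace.countableBasis (Fin N → X)
  have hbasis := TopologicalSpace.isBasis_countableBasis (Fin N → X)
  have hcount : Countable 𝓑 := (TopologicalSpace.countable_countableBasis (Fin N → X)).to_subtype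
  choose δ hδ hdense using fun V : 𝓑 => h V (TopologicalSpace.isOpen_of_mem_countableBasis V.2)
    (TopologicalSpace.nonempty_of_mem_countableBasis V.2)
  -- A point lying in `G (V, m)` for all `m` visits `V` along dense windows of density `δ V`;
  -- density of `G` in `X` uses that `δ V` is independent of `O`.
  let G : 𝓑 × ℕ → Set X := fun q => ⋃ M ≥ q.2, ⋃ k ∈ K,
    {x | δ q.1 * M < (({n | (fun s => (T s ^ n) x) ∈ (q.1 : Set (Fin N → X))} ∩
      Set.Icc (k + 1) (k + M)).ncard : ℝ)}
  have hopen : ∀ q, IsOpen (G q) := fun q =>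
    isOpen_biUnion fun M _ => isOpen_biUnion fun k _ =>
      isOpen_window_visits (f := fun n x => fun s => (T s ^ n) x)
        (fun n => continuous_pi fun s => (T s ^ n).continuous)
        (TopologicalSpace.isOpen_of_mem_countableBasis q.1.2) _ k M
  have hdenseG : ∀ q, Dense (G q) := fun q => dense_iff_inter_open.2 fun O hO hOne => by
    obtain ⟨x, hxO, hx⟩ := hdense q.1 O hO hOne
    obtain ⟨M, hM, k, hk, hlt⟩ := hx q.2
    exact ⟨x, hxO, Set.mem_iUnion₂.2 ⟨M, hM, Set.mem_iUnion₂.2 ⟨k, hk, hlt⟩⟩⟩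
  obtain ⟨x, hx⟩ := (dense_iInter_of_isOpen hopen hdenseG).nonempty
  refine ⟨x, fun V hV ⟨y, hy⟩ => ?_⟩
  obtain ⟨V', hV', -, hsub⟩ := hbasis.exists_subset_of_mem_open hy hV
  refine ⟨δ ⟨V', hV'⟩, hδ _, HasDenseWindows.mono (fun m => ?_) fun n hn => hsub hn⟩
  obtain ⟨M, hM, hx'⟩ := Set.mem_iUnion₂.1 (Set.mem_iInter.1 hx (⟨V', hV'⟩, m))
  obtain ⟨k, hk, hlt⟩ := Set.mem_iUnion₂.1 hx'
  exact ⟨M, hM, k, hk, hlt⟩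

end Baire

end DisjointHypercyclic

open DisjointHypercyclic in
/-- The sums are taken in `[0, ∞]`, where `1 / 0 = ∞`; so the first condition contains that no
product `W^s_{j,n}` vanishes. Indices `j` start at `0`. -/
theorem mainTheorem9 {𝕜 : Type*} [RCLike 𝕜] (p : ℝ≥0∞) [Fact (1 ≤ p)] (hp : p ≠ ∞)
    (N : ℕ) (hN : 2 ≤ N) (w : Fin N → ℕ → 𝕜)
    (hw : ∀ s, BddAbove (Set.range fun n => ‖w s n‖))
    (𝒜 : Set (Set ℕ)) (h𝒜 : 𝒜 = posUpperBanachDensity ∨ 𝒜 = posUpperDensity) :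
    IsDisjointHypercyclic 𝒜 (fun s => weightedShift p (w s) (hw s)) ↔
      (∀ (j : ℕ) (s : Fin N),
        ∑' n : ℕ, 1 / ‖weightProd (w s) j (n + 1)‖ₑ ^ p.toReal < ∞) ∧
      (∀ l : ℕ, 1 ≤ l → ∀ a : Fin N → Fin l → 𝕜, (∀ s j, a s j ≠ 0) → ∀ ε : ℝ, 0 < ε →
        ∃ A ∈ 𝒜, ∀ s t : Fin N, s ≠ t → ∀ n ∈ A,
          (∀ j : Fin l,
            ∑' m : {m : ℕ // m ∈ A ∧ n < m},
              ‖weightProd (w s) (j + m - n) n‖ₑ ^ p.toReal /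
                ‖weightProd (w t) j m‖ₑ ^ p.toReal ≤ ENNReal.ofReal ε) ∧
          (∀ j : Fin l,
            ‖weightProd (w s) j n / weightProd (w t) j n - a s j / a t j‖ ≤ ε)) := by
  obtain ⟨K, hK⟩ := exists_windows_of_family h𝒜
  constructor
  · rintro ⟨x, hx⟩
    have hret : ∀ (y : Fin N → lp (fun _ : ℕ => 𝕜) p) (η : ℝ), 0 < η →
        ∃ δ > 0, HasDenseWindows K δ
          {n | ∀ s, ‖(weightedShift p (w s) (hw s) ^ n) x - y s‖ < η} :=
      fun y η hη => (hK _).1 (return_set_mem hx y hη)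
    refine ⟨fun j s => ?_, fun l hl a ha ε hε => ?_⟩
    · obtain ⟨δ, hδ, hA⟩ := hret (fun _ => lp.single p 0 (1 : 𝕜)) (1 / 2) (by norm_num)
      exact tsum_one_div_weightProd_lt_top hp (hw s) hδ (hA.mono fun n hn => hn s) j
    · obtain ⟨A, hA, hA'⟩ := exists_ratio_set hp hret hl ha hε
      exact ⟨A, (hK A).2 hA, fun s t _ n hn => hA' s t n hn⟩
  · rintro ⟨h1, h2⟩
    have := separableSpace_lp (𝕜 := 𝕜) hp
    have := UniformSpace.secondCountable_of_separable (lp (fun _ : ℕ => 𝕜) p)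
    -- Any shift may serve as the reference whose weights define the blocks.
    let t : Fin N := ⟨0, by omega⟩
    obtain ⟨x, hx⟩ := exists_vector_of_dense_visits (fun s => weightedShift p (w s) (hw s))
      fun V hV hVne => exists_dense_visits hp t h1 (fun l hl a ha ε hε => by
        obtain ⟨A, hA, hA'⟩ := h2 l hl a ha ε hε
        exact ⟨A, (hK A).1 hA, fun s hst n hn => hA' s t hst n hn⟩) hV hVne
    refine ⟨x, fun V hV hVne => (hK _).2 ?_⟩
    simpa only [piMap_pow_apply] using hx V hV hVne
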